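/- A *Jacobi matrix* is a bounded self-adjoint operator $J=J_{a,b}$ on $\ell^2(\mathbb Z)$ given by $(J\varphi)_n=a_{n-1}\varphi_{n-1}+b_n\varphi_n+a_n\varphi_{n+1}$, where $a,b\in\ell^\infty(\mathbb Z,\mathbb R)$ and $\inf_n a_n>0$. It is *$q$-periodic* ($q\in\mathbb Z$, $q\ge 1$) if $a_{n+q}=a_n$ and $b_{n+q}=b_n$ for all $n\in\mathbb Z$. For $R>0$, let $\mathcal J(R)$ be the set of all Jacobi matrices $J_{a,b}$ with $\|J_{a,b}\|\le R$ and $\inf_n a_n\ge R^{-1}$. Let $X$ be the position operator $(X\varphi)_n=n\varphi_n$ with domain $D(X)=\{\varphi\in\ell^2(\mathbb Z):\sum_n|n\varphi_n|^2<\infty\}$, and let $X_J(t)=e^{itJ}Xe^{-itJ}$, $t\in\mathbb R$, be its Heisenberg evolution, defined on $\{\varphi : e^{-itJ}\varphi\in D(X)\}$. **Corollary.** For every $R>0$ there is a constant $C_1=C_1(R)>1$, depending only on $R$, such that the following holds for every $q\ge 1$ and every $q$-periodic $J\in\mathcal J(R)$. The strong limit $$Q_J=\operatorname*{s-lim}_{t\to\infty}\frac1t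 X_J(t)$$ exists on $D(X)$ and defines a bounded self-adjoint operator $Q_J$ on $\ell^2(\mathbb Z)$; and for every $\varphi\in D(X)$ and every $t>0$ one has $\varphi\in\ell^1(\mathbb Z)$, $\varphi\in D(X_J(t))$ and $$\Bigl\|Q_J\varphi-\frac1t X_J(t)\varphi\Bigr\|\le \frac1t\|X\varphi\|+C_1^{\,q}\,\|\varphi\|_1\,t^{-1/5},$$ where $\|\varphi\|_1=\sum_n|\varphi_n|$ is the $\ell^1$ norm. -/

import Mathlib

open Filter Topology
open scoped lp ENNReal

noncomputable section

namespace JacobiTransport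

/-- The Hilbert space `ℓ²(ℤ)` of square-summable complex sequences. -/
abbrev H : Type := ℓ²(ℤ, ℂ)

theorem memlp_shift (k : ℤ) (φ : H) : Memℓp (fun n : ℤ => φ (n + k)) 2 := by
  have h := (memℓp_gen_iff (p := 2) (by norm_num)).1 (lp.memℓp φ)
  exact memℓp_gen ((Equiv.addRight k).summable_iff.2 h)

/-- The translation `(S_k φ)_n = φ_{n+k}`, as a bounded operator on `ℓ²(ℤ)`. -/
def shift (k : ℤ) : H →L[ℂ] H :=
  LinearMap.mkContinuous
    { toFun := fun φ => ⟨fun n => φ (n + k), memlp_shift k φ⟩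
      map_add' := fun φ ψ => by ext n; rfl
      map_smul' := fun c φ => by ext n; simp }
    1 (fun φ => by
      rw [one_mul]
      refine le_of_eq ?_
      rw [lp.norm_eq_tsum_rpow (by norm_num), lp.norm_eq_tsum_rpow (by norm_num)]
      congr 1
      exact (Equiv.addRight k).tsum_eq (fun n : ℤ => ‖φ n‖ ^ (2 : ℝ≥0∞).toReal))

@[simp] theorem shift_apply (k : ℤ) (φ : H) (n : ℤ) : shift k φ n = φ (n + k) := rfl

theorem memlp_mul (c : ℓ^∞(ℤ, ℝ)) (φ : H) : Memℓp (fun n : ℤ => (c n : ℂ) * φ n) 2 := by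
  refine (lp.memℓp (‖c‖ • φ)).mono' (fun n => ?_)
  simp only [norm_mul, Complex.norm_real, lp.coeFn_smul, Pi.smul_apply, norm_smul, norm_norm]
  exact mul_le_mul_of_nonneg_right (lp.norm_apply_le_norm (by simp) c n) (norm_nonneg _)

/-- Multiplication by a bounded real sequence, as a bounded operator on `ℓ²(ℤ)`. -/
def diag (c : ℓ^∞(ℤ, ℝ)) : H →L[ℂ] H :=
  LinearMap.mkContinuous
    { toFun := fun φ => ⟨fun n => (c n : ℂ) * φ n, memlp_mul c φ⟩
      map_add' := fun φ ψ => by ext n; exact mul_add _ _ _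
      map_smul' := fun z φ => by ext n; simp [mul_left_comm] }
    ‖c‖ (fun φ => by
      have h : ‖c‖ * ‖φ‖ = ‖‖c‖ • φ‖ := by rw [norm_smul, norm_norm]
      rw [h]
      refine lp.norm_mono (by norm_num) (fun n => ?_)
      simp only [LinearMap.coe_mk, AddHom.coe_mk, norm_mul, Complex.norm_real, lp.coeFn_smul,
        Pi.smul_apply, norm_smul, norm_norm]
      exact mul_le_mul_of_nonneg_right (lp.norm_apply_le_norm (by simp) c n) (norm_nonneg _))

@[simp] theorem diag_apply (c : ℓ^∞(ℤ, ℝ)) (φ : H) (n : ℤ) :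
    diag c φ n = (c n : ℂ) * φ n := rfl

/-- The Jacobi operator `J_{a,b}` on `ℓ²(ℤ)` with coefficients `a, b ∈ ℓ^∞(ℤ, ℝ)`; it acts by
`(J φ)_n = a_{n-1} φ_{n-1} + b_n φ_n + a_n φ_{n+1}`, see `jacobi_apply`. -/
def jacobi (a b : ℓ^∞(ℤ, ℝ)) : H →L[ℂ] H :=
  (shift (-1)).comp (diag a) + diag b + (diag a).comp (shift 1)

theorem jacobi_apply (a b : ℓ^∞(ℤ, ℝ)) (φ : H) (n : ℤ) :
    jacobi a b φ n = (a (n - 1) : ℂ) * φ (n - 1) + (b n : ℂ) * φ n + (a n : ℂ) * φ (n + 1) := by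
  simp [jacobi, sub_eq_add_neg]

/-- `J_{a,b}` belongs to the class `𝒥(R)`: it is a Jacobi matrix (`inf_n a_n > 0`) with
`‖J_{a,b}‖ ≤ R` and `inf_n a_n ≥ R⁻¹`. -/
structure InClass (R : ℝ) (a b : ℓ^∞(ℤ, ℝ)) : Prop where
  iInf_pos : 0 < ⨅ n : ℤ, a n
  norm_le : ‖jacobi a b‖ ≤ R
  inv_le_iInf : R⁻¹ ≤ ⨅ n : ℤ, a n

/-- `J_{a,b}` is `q`-periodic. -/
def IsPeriodic (q : ℕ) (a b : ℓ^∞(ℤ, ℝ)) : Prop :=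
  0 < q ∧ ∀ n : ℤ, a (n + q) = a n ∧ b (n + q) = b n

/-- The position operator `(X φ)_n = n φ_n` with domain
`D(X) = {φ ∈ ℓ²(ℤ) : ∑ |n φ_n|² < ∞}`. -/
def position : H →ₗ.[ℂ] H where
  domain :=
    { carrier := {φ | Memℓp (fun n : ℤ => (n : ℂ) * φ n) 2}
      add_mem' := fun {φ ψ} hφ hψ => by
        have h := Memℓp.add hφ hψ
        refine (congrArg (fun f : ℤ → ℂ => Memℓp f 2) ?_).mp h
        ext n; simp [mul_add]
      zero_mem' := by
        refine (congrArg (fun f : ℤ → ℂ => Memℓp f 2) ?_).mp (zero_memℓp (E := fun _ : ℤ => ℂ))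
        ext n; simp
      smul_mem' := fun c φ hφ => by
        have h := Memℓp.const_smul hφ c
        refine (congrArg (fun f : ℤ → ℂ => Memℓp f 2) ?_).mp h
        ext n; simp [mul_left_comm] }
  toFun :=
    { toFun := fun φ => ⟨fun n => (n : ℂ) * (φ : H) n, φ.2⟩
      map_add' := fun φ ψ => by ext n; exact mul_add _ _ _
      map_smul' := fun z φ => by ext n; simp [mul_left_comm] }

theorem position_apply (φ : position.domain) (n : ℤ) : position φ n = (n : ℂ) * (φ : H) n := rfl

/-- The unitary group `e^{itJ}`. -/
def evol (J : H →L[ℂ] H) (t : ℝ) : H →L[ℂ] H :=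
  NormedSpace.exp ((Complex.I * (t : ℂ)) • J)

/-- The Heisenberg evolution `X_J(t) = e^{itJ} X e^{-itJ}` of the position operator, with its
natural domain `{φ : e^{-itJ} φ ∈ D(X)}`. -/
def heisenberg (J : H →L[ℂ] H) (t : ℝ) : H →ₗ.[ℂ] H where
  domain := position.domain.comap (evol J (-t) : H →ₗ[ℂ] H)
  toFun :=
    { toFun := fun φ => evol J t (position ⟨evol J (-t) (φ : H), φ.2⟩)
      map_add' := fun φ ψ => by
        rw [← map_add, ← LinearPMap.map_add]
        congr 2
        exact Subtype.ext (map_add (evol J (-t)) (φ : H) (ψ : H))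
      map_smul' := fun z φ => by
        rw [RingHom.id_apply, ← map_smul, ← LinearPMap.map_smul]
        congr 2
        exact Subtype.ext (map_smul (evol J (-t)) z (φ : H)) }

theorem heisenberg_apply (J : H →L[ℂ] H) (t : ℝ) (φ : (heisenberg J t).domain) :
    heisenberg J t φ = evol J t (position ⟨evol J (-t) (φ : H), φ.2⟩) := rfl

/-- `Q` is a bounded self-adjoint operator with `Q = s-lim_{t → ∞} t⁻¹ X_J(t)`, the strong limit
being taken on `D(X)` (on which every `X_J(t)` has to be defined). As `D(X)` is dense in `ℓ²(ℤ)`,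
at most one bounded `Q` has this property. -/
def IsAsymptoticVelocity (J Q : H →L[ℂ] H) : Prop :=
  IsSelfAdjoint Q ∧
    ∀ φ ∈ position.domain, ∃ h : ∀ t : ℝ, φ ∈ (heisenberg J t).domain,
      Tendsto (fun t : ℝ => ((t⁻¹ : ℝ) : ℂ) • heisenberg J t ⟨φ, h t⟩) atTop (𝓝 (Q φ))

open Classical in
/-- The operator `Q_J = s-lim_{t → ∞} t⁻¹ X_J(t)`
(with the value `0` if the strong limit does not exist). -/
def asymptoticVelocity (J : H →L[ℂ] H) : H →L[ℂ] H :=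
  if h : ∃ Q : H →L[ℂ] H, IsAsymptoticVelocity J Q then h.choose else 0

end JacobiTransport

end

open JacobiTransport

/-! With V = i[J, X], which is bounded, differentiating e^{itJ} X e^{-itJ} gives X_J(t) = X + ∫₀ᵗ
e^{iτJ} V e^{-iτJ} dτ on D(X) (`heisenberg_eq`). Dividing by t isolates the term ‖Xφ‖/t, and what
remains is to show that the time averages of V converge at a controlled rate.

By periodicity the Bloch transform turns J and V into q × q matrices depending on θ. In an
eigenbasis of the fibre the diagonal entries of a time average do not depend on time, while the
off-diagonal ones are O(1/(g t)), g being the least eigenvalue gap (`norm_timeAverage_sub_le`). The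
essential input is `gap_bound`: g is at least |sin(qθ)| times a constant exponentially small in q.
If two orthogonal Bloch solutions with the same multiplier ζ had close energies and ζ² ≠ 1, their
Wronskian would be small, so their initial data would be almost parallel; transfer-matrix growth
would keep them almost parallel over a period, against orthogonality.

The squared fibre error is thus at most a multiple of 1/(1 + (t sin(qθ)/κ)²), with κ exponential in
q (`fiber_dephasing`). Its integral over θ is O(κ/t) (`integral_lorentz_le`), so Parseval gives an
error O(t^{-1/2}) on each unit vector for t ≥ 1. This is stronger than t^{-1/5}; for t ≤ 1 the
trivial bound suffices. Linearity sums the unit-vector bounds to the ℓ¹ norm, and uniform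
boundedness of the averages gives the strong limit on all of ℓ² (`exists_strong_limit`). -/

noncomputable section

namespace JacobiTransport

/-! ### Exponentials, conjugation and time averages on Banach spaces -/

section Propagator

variable {E F : Type*} [NormedAddCommGroup E] [NormedSpace ℂ E] [CompleteSpace E]
  [NormedAddCommGroup F] [NormedSpace ℂ F] [CompleteSpace F]

theorem hasSum_exp_apply (A : E →L[ℂ] E) (x : E) :
    HasSum (fun n : ℕ => ((n.factorial : ℂ)⁻¹) • (A ^ n) x) (NormedSpace.exp A x) := by
  have h := NormedSpace.exp_series_hasSum_exp' (𝕂 := ℂ) A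
  have h2 := h.mapL (ContinuousLinearMap.apply ℂ E x)
  simpa only [map_smul, ContinuousLinearMap.apply_apply] using h2

/-- An intertwiner of two bounded operators intertwines their exponentials. -/
theorem exp_intertwine {A : E →L[ℂ] E} {B : F →L[ℂ] F} (L : E →L[ℂ] F)
    (h : L ∘L A = B ∘L L) (x : E) :
    L (NormedSpace.exp A x) = NormedSpace.exp B (L x) := by
  have hp : ∀ n : ℕ, L ((A ^ n) x) = (B ^ n) (L x) := by
    intro n
    induction n with
    | zero => simp
    | succ n ih =>
      rw [pow_succ', pow_succ']
      have := DFunLike.congr_fun h ((A ^ n) x)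
      simp only [ContinuousLinearMap.comp_apply] at this
      simp only [mul_apply_eq_comp, this, ih]
  have h1 := L.hasSum (hasSum_exp_apply A x)
  have h2 := hasSum_exp_apply B (L x)
  simp only [map_smul, hp] at h1
  exact h1.unique h2

/-- A closed subspace that is invariant under `A` is invariant under `exp A`. -/
theorem exp_mem_of_invariant {A : E →L[ℂ] E} (S : Submodule ℂ E) (hS : IsClosed (S : Set E))
    (h : ∀ x ∈ S, A x ∈ S) {x : E} (hx : x ∈ S) : NormedSpace.exp A x ∈ S := by
  have hp : ∀ n : ℕ, (A ^ n) x ∈ S := by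
    intro n
    induction n with
    | zero => simpa
    | succ n ih => rw [pow_succ']; exact h _ ih
  refine hS.mem_of_tendsto (hasSum_exp_apply A x) (Eventually.of_forall fun s => ?_)
  exact S.sum_mem fun n _ => S.smul_mem _ (hp n)

/-- The group `e^{itJ}` generated by a bounded operator `J`. -/
def propagator (J : E →L[ℂ] E) (t : ℝ) : E →L[ℂ] E :=
  NormedSpace.exp ((Complex.I * (t : ℂ)) • J)

theorem hasDerivAt_propagator (J : E →L[ℂ] E) (t : ℝ) :
    HasDerivAt (propagator J) (Complex.I • (J * propagator J t)) t := by
  have h := (hasDerivAt_exp_smul_const' (𝕂 := ℂ) (Complex.I • J) (t : ℂ)).scomp t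
    Complex.ofRealCLM.hasDerivAt
  rw [Complex.ofRealCLM_apply, Complex.ofReal_one, one_smul] at h
  have e : ∀ s : ℝ, (s : ℂ) • (Complex.I • J) = (Complex.I * (s : ℂ)) • J := fun s => by
    rw [smul_smul, mul_comm]
  simp only [Function.comp_def, e] at h
  rw [smul_mul_assoc] at h
  exact h

theorem continuous_propagator (J : E →L[ℂ] E) : Continuous (propagator J) :=
  continuous_iff_continuousAt.2 fun t => (hasDerivAt_propagator J t).continuousAt

omit [CompleteSpace E] in
@[simp] theorem propagator_zero (J : E →L[ℂ] E) : propagator J 0 = 1 := by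
  simp [propagator]

theorem propagator_mul_neg (J : E →L[ℂ] E) (t : ℝ) :
    propagator J t * propagator J (-t) = 1 := by
  let : NormedAlgebra ℚ (E →L[ℂ] E) := NormedAlgebra.restrictScalars ℚ ℂ (E →L[ℂ] E)
  unfold propagator
  rw [← NormedSpace.exp_add_of_commute]
  · simp
  · exact ((Commute.refl J).smul_left _).smul_right _

theorem propagator_comm (J : E →L[ℂ] E) (t : ℝ) : J * propagator J t = propagator J t * J := by
  ext x
  exact exp_intertwine J (by ext y; simp) x

theorem propagator_intertwine {A : E →L[ℂ] E} {B : F →L[ℂ] F} {L : E →L[ℂ] F}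
    (h : L ∘L A = B ∘L L) (t : ℝ) (x : E) :
    L (propagator A t x) = propagator B t (L x) := by
  refine exp_intertwine L ?_ x
  rw [ContinuousLinearMap.comp_smul, h, ContinuousLinearMap.smul_comp]

/-- An eigenvector of `J` is an eigenvector of `e^{itJ}`. -/
theorem propagator_eigenvector {J : E →L[ℂ] E} {c : ℂ} {x : E} (h : J x = c • x) (t : ℝ) :
    propagator J t x = Complex.exp (Complex.I * t * c) • x := by
  have hp : ∀ n : ℕ, (((Complex.I * (t : ℂ)) • J) ^ n) x = (Complex.I * t * c) ^ n • x := by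
    intro n
    induction n with
    | zero => simp
    | succ n ih =>
      rw [pow_succ', mul_apply_eq_comp, ih, map_smul, smul_apply, h, smul_smul, smul_smul, pow_succ]
      congr 1
      ring
  have h3 := hasSum_exp_apply ((Complex.I * (t : ℂ)) • J) x
  have h4 := (NormedSpace.exp_series_hasSum_exp' (𝕂 := ℂ) (Complex.I * t * c)).smul_const x
  rw [← Complex.exp_eq_exp_ℂ] at h4
  refine h3.unique ?_
  simpa only [hp, smul_smul, smul_eq_mul] using h4

/-- The integrand `e^{iτJ} P e^{-iτJ}`. -/
def conjugated (J P : E →L[ℂ] E) (τ : ℝ) : E →L[ℂ] E :=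
  propagator J τ * P * propagator J (-τ)

theorem continuous_conjugated (J P : E →L[ℂ] E) : Continuous (conjugated J P) :=
  ((continuous_propagator J).mul continuous_const).mul
    ((continuous_propagator J).comp continuous_neg)

/-- The time average `t⁻¹ ∫₀ᵗ e^{iτJ} P e^{-iτJ} dτ`. -/
def timeAverage (J P : E →L[ℂ] E) (t : ℝ) : E →L[ℂ] E :=
  ((t⁻¹ : ℝ) : ℂ) • ∫ τ in (0 : ℝ)..t, conjugated J P τ

theorem timeAverage_apply (J P : E →L[ℂ] E) (t : ℝ) (x : E) :
    timeAverage J P t x = ((t⁻¹ : ℝ) : ℂ) • ∫ τ in (0 : ℝ)..t, conjugated J P τ x := by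
  unfold timeAverage
  rw [smul_apply, ContinuousLinearMap.intervalIntegral_apply
    ((continuous_conjugated J P).intervalIntegrable _ _)]

theorem continuous_conjugated_apply (J P : E →L[ℂ] E) (x : E) :
    Continuous fun τ => conjugated J P τ x :=
  (continuous_conjugated J P).clm_apply continuous_const

/-- The transfer principle: it moves time averages from ℓ¹ to ℓ², and from ℓ¹ to each Bloch fibre,
through bounded maps that need not be isometric. This is why the propagator is set up on general
Banach spaces. -/
theorem timeAverage_intertwine {J P : E →L[ℂ] E} {J' P' : F →L[ℂ] F} {L : E →L[ℂ] F}
    (hJ : L ∘L J = J' ∘L L) (hP : L ∘L P = P' ∘L L) (t : ℝ) (x : E) :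
    L (timeAverage J P t x) = timeAverage J' P' t (L x) := by
  rw [timeAverage_apply, timeAverage_apply, map_smul, ← ContinuousLinearMap.intervalIntegral_comp_comm
    L ((continuous_conjugated_apply J P x).intervalIntegrable _ _)]
  congr 2
  ext τ
  have hP' : ∀ y, L (P y) = P' (L y) := fun y => DFunLike.congr_fun hP y
  simp only [conjugated, mul_apply_eq_comp, propagator_intertwine hJ, hP']

end Propagator

/-! ### Unitarity, and boundedness and symmetry of time averages -/

section Hilbert

open scoped InnerProductSpace

variable {E : Type*} [NormedAddCommGroup E] [InnerProductSpace ℂ E] [CompleteSpace E]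

theorem star_propagator {J : E →L[ℂ] E} (hJ : IsSelfAdjoint J) (t : ℝ) :
    star (propagator J t) = propagator J (-t) := by
  unfold propagator
  rw [NormedSpace.star_exp, star_smul, hJ.star_eq]
  congr 2
  simp

theorem norm_propagator_apply {J : E →L[ℂ] E} (hJ : IsSelfAdjoint J) (t : ℝ) (x : E) :
    ‖propagator J t x‖ = ‖x‖ := by
  have h : ⟪propagator J t x, propagator J t x⟫_ℂ = ⟪x, x⟫_ℂ := by
    rw [← ContinuousLinearMap.adjoint_inner_left, ← ContinuousLinearMap.star_eq_adjoint,
      star_propagator hJ, ← mul_apply_eq_comp]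
    have := propagator_mul_neg J (-t)
    rw [neg_neg] at this
    rw [this]; rfl
  rw [inner_self_eq_norm_sq_to_K, inner_self_eq_norm_sq_to_K] at h
  have h' : ‖propagator J t x‖ ^ 2 = ‖x‖ ^ 2 := by exact_mod_cast h
  exact (sq_eq_sq₀ (norm_nonneg _) (norm_nonneg _)).1 h'

theorem norm_conjugated_apply_le {J : E →L[ℂ] E} (hJ : IsSelfAdjoint J) (P : E →L[ℂ] E) (τ : ℝ)
    (x : E) : ‖conjugated J P τ x‖ ≤ ‖P‖ * ‖x‖ := by
  simp only [conjugated, mul_apply_eq_comp, norm_propagator_apply hJ]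
  refine (P.le_opNorm _).trans_eq ?_
  rw [norm_propagator_apply hJ]

theorem norm_timeAverage_apply_le {J : E →L[ℂ] E} (hJ : IsSelfAdjoint J) (P : E →L[ℂ] E)
    {t : ℝ} (ht : 0 < t) (x : E) : ‖timeAverage J P t x‖ ≤ ‖P‖ * ‖x‖ := by
  rw [timeAverage_apply, norm_smul, Complex.norm_real, Real.norm_of_nonneg (inv_nonneg.2 ht.le)]
  have h := intervalIntegral.norm_integral_le_of_norm_le_const (a := 0) (b := t)
    (fun τ _ => norm_conjugated_apply_le hJ P τ x)
  rw [sub_zero, abs_of_pos ht] at h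
  calc t⁻¹ * ‖∫ τ in (0 : ℝ)..t, conjugated J P τ x‖ ≤ t⁻¹ * (‖P‖ * ‖x‖ * t) := by gcongr
    _ = ‖P‖ * ‖x‖ := by field_simp

theorem inner_timeAverage {J P : E →L[ℂ] E} (t : ℝ) (x y : E) :
    ⟪x, timeAverage J P t y⟫_ℂ
      = ((t⁻¹ : ℝ) : ℂ) * ∫ τ in (0 : ℝ)..t, ⟪x, conjugated J P τ y⟫_ℂ := by
  rw [timeAverage_apply, inner_smul_right]
  congr 1
  exact (ContinuousLinearMap.intervalIntegral_comp_comm (innerSL ℂ x)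
    ((continuous_conjugated_apply J P y).intervalIntegrable _ _)).symm

theorem inner_propagator_left {J : E →L[ℂ] E} (hJ : IsSelfAdjoint J) (t : ℝ) (x y : E) :
    ⟪propagator J t x, y⟫_ℂ = ⟪x, propagator J (-t) y⟫_ℂ := by
  rw [← star_propagator hJ t, ContinuousLinearMap.star_eq_adjoint,
    ContinuousLinearMap.adjoint_inner_right]

theorem inner_timeAverage_left {J P : E →L[ℂ] E} (hJ : IsSelfAdjoint J) (hP : IsSelfAdjoint P)
    (t : ℝ) (x y : E) :
    ⟪timeAverage J P t x, y⟫_ℂ = ⟪x, timeAverage J P t y⟫_ℂ := by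
  rw [← inner_conj_symm, inner_timeAverage, inner_timeAverage, map_mul, Complex.conj_ofReal]
  congr 1
  simp only [intervalIntegral, map_sub, ← integral_conj]
  congr 2 <;> ext τ
  all_goals
    rw [inner_conj_symm]
    simp only [conjugated, mul_apply_eq_comp]
    have hP' : ∀ u v, ⟪P u, v⟫_ℂ = ⟪u, P v⟫_ℂ := hP.isSymmetric
    rw [inner_propagator_left hJ, hP', ← neg_neg τ, ← inner_propagator_left hJ, neg_neg]

end Hilbert

/-! ### The position operator as an integral of the velocity -/

section Heisenberg

theorem hasDerivAt_clm_apply_complex {E F : Type*} [NormedAddCommGroup E] [NormedSpace ℂ E]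
    [NormedAddCommGroup F] [NormedSpace ℂ F] {c : ℝ → E →L[ℂ] F} {c' : E →L[ℂ] F} {u : ℝ → E}
    {u' : E} {t : ℝ} (hc : HasDerivAt c c' t) (hu : HasDerivAt u u' t) :
    HasDerivAt (fun s => c s (u s)) (c' (u t) + c t u') t := by
  have h := ((ContinuousLinearMap.restrictScalarsL ℂ E F ℝ ℝ).hasFDerivAt (x := c t)).comp_hasDerivAt
    t hc
  exact h.clm_apply hu

/-- The commutator `[J, X]` of a Jacobi operator with the position operator. -/
def positionCommutator (a : ℓ^∞(ℤ, ℝ)) : H →L[ℂ] H :=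
  (diag a).comp (shift 1) - (shift (-1)).comp (diag a)

/-- The velocity operator `i[J, X]`. -/
def velocity (a : ℓ^∞(ℤ, ℝ)) : H →L[ℂ] H := Complex.I • positionCommutator a

/-- The graph of the position operator, as a subspace of `ℓ²(ℤ) × ℓ²(ℤ)`. -/
def positionGraph : Submodule ℂ (H × H) where
  carrier := {p | ∀ n : ℤ, p.2 n = (n : ℂ) * p.1 n}
  add_mem' := fun {p r} hp hr n => by
    have h1 := hp n
    have h2 := hr n
    simp [h1, h2, mul_add]
  zero_mem' := fun n => by simp
  smul_mem' := fun c p hp n => by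
    have h1 := hp n
    simp [h1, mul_left_comm]

theorem mem_positionGraph {p : H × H} :
    p ∈ positionGraph ↔ ∀ n : ℤ, p.2 n = (n : ℂ) * p.1 n := Iff.rfl

theorem continuous_coord (n : ℤ) : Continuous fun φ : H => φ n :=
  (lp.evalCLM ℂ (fun _ : ℤ => ℂ) 2 n).continuous

theorem isClosed_positionGraph : IsClosed (positionGraph : Set (H × H)) := by
  have h : (positionGraph : Set (H × H)) = ⋂ n : ℤ, {p | p.2 n = (n : ℂ) * p.1 n} := by
    ext p; simp [mem_positionGraph]
  rw [h]
  exact isClosed_iInter fun n => isClosed_eq ((continuous_coord n).comp continuous_snd)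
    (continuous_const.mul ((continuous_coord n).comp continuous_fst))

/-- The action of `J` on the graph of the position operator. -/
def graphJacobi (a b : ℓ^∞(ℤ, ℝ)) : H × H →L[ℂ] H × H :=
  ((jacobi a b) ∘L (ContinuousLinearMap.fst ℂ H H)).prod
    ((jacobi a b) ∘L (ContinuousLinearMap.snd ℂ H H)
      - (positionCommutator a) ∘L (ContinuousLinearMap.fst ℂ H H))

/-- For χ = Xφ the second component Jχ - [J, X]φ equals XJφ. The unbounded X is thus handled by a
bounded operator that preserves the closed graph of X, and exponentiating it shows that e^{-itJ}
preserves D(X). -/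
theorem graphJacobi_mem {a b : ℓ^∞(ℤ, ℝ)} {p : H × H} (hp : p ∈ positionGraph) :
    graphJacobi a b p ∈ positionGraph := by
  rw [mem_positionGraph] at hp ⊢
  intro n
  simp [graphJacobi, positionCommutator, jacobi_apply, hp, ← sub_eq_add_neg]
  ring

/-- The Heisenberg evolution of the position operator is the integral of the velocity. -/
theorem propagator_position {a b : ℓ^∞(ℤ, ℝ)} {φ χ : H}
    (h : (φ, χ) ∈ positionGraph) (t : ℝ) :
    ∃ ψ : H, (propagator (jacobi a b) (-t) φ, ψ) ∈ positionGraph ∧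
      propagator (jacobi a b) t ψ
        = χ + ∫ τ in (0 : ℝ)..t, conjugated (jacobi a b) (velocity a) τ φ := by
  set J := jacobi a b
  set z : ℝ → H × H := fun s => propagator (graphJacobi a b) (-s) (φ, χ) with hz
  have hfst : ∀ s, (z s).1 = propagator J (-s) φ := fun s =>
    propagator_intertwine (A := graphJacobi a b) (B := J) (L := ContinuousLinearMap.fst ℂ H H)
      (by ext x <;> simp [graphJacobi, J]) (-s) (φ, χ)
  have hmem : ∀ s, z s ∈ positionGraph := fun s =>
    exp_mem_of_invariant positionGraph isClosed_positionGraph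
      (fun x hx => positionGraph.smul_mem _ (graphJacobi_mem hx)) h
  have hzd : ∀ s, HasDerivAt z (-(Complex.I • graphJacobi a b (z s))) s := by
    intro s
    have h1 := (hasDerivAt_propagator (graphJacobi a b) (-s)).scomp s (hasDerivAt_neg s)
    have h2 := hasDerivAt_clm_apply_complex h1 (hasDerivAt_const s (φ, χ))
    exact h2.congr_deriv (by simp [hz])
  -- The terms containing J applied to the second component cancel, since J commutes with its
  -- propagator; only the commutator survives.
  have hg : ∀ s, HasDerivAt (fun s => propagator J s (z s).2)
      (conjugated J (velocity a) s φ) s := by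
    intro s
    have h1 := hasDerivAt_clm_apply_complex (hasDerivAt_propagator J s) (hzd s).snd
    refine h1.congr_deriv ?_
    have hc := DFunLike.congr_fun (propagator_comm J s) (z s).2
    simp only [mul_apply_eq_comp] at hc
    simp only [smul_apply, mul_apply_eq_comp, hc, conjugated, velocity, Prod.snd_neg,
      Prod.smul_snd, map_neg, map_smul, graphJacobi, ContinuousLinearMap.prod_apply,
      sub_apply, ContinuousLinearMap.comp_apply, ContinuousLinearMap.coe_fst',
      ContinuousLinearMap.coe_snd', map_sub, smul_sub, hfst]
    simp [J]
  refine ⟨(z t).2, ?_, ?_⟩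
  · rw [← hfst]; exact hmem t
  · have h1 := intervalIntegral.integral_eq_sub_of_hasDerivAt (a := 0) (b := t)
      (fun s _ => hg s) ((continuous_conjugated_apply J (velocity a) φ).intervalIntegrable _ _)
    rw [h1]
    simp [hz]

theorem heisenberg_eq {a b : ℓ^∞(ℤ, ℝ)} (φ : position.domain) (t : ℝ) :
    ∃ ht : (φ : H) ∈ (heisenberg (jacobi a b) t).domain,
      heisenberg (jacobi a b) t ⟨φ, ht⟩
        = position φ + ∫ τ in (0 : ℝ)..t, conjugated (jacobi a b) (velocity a) τ (φ : H) := by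
  obtain ⟨ψ, hψ, h⟩ := propagator_position (a := a) (b := b) (φ := φ) (χ := position φ)
    (fun n => position_apply φ n) t
  have ht : evol (jacobi a b) (-t) (φ : H) ∈ position.domain := by
    have h1 := lp.memℓp ψ
    rw [show (ψ : ℤ → ℂ) = fun n : ℤ => (n : ℂ) * propagator (jacobi a b) (-t) φ n from
      funext hψ] at h1
    exact h1
  refine ⟨ht, ?_⟩
  rw [← h, heisenberg_apply]
  have e : position ⟨evol (jacobi a b) (-t) (φ : H), ht⟩ = ψ := by
    ext n
    rw [position_apply, hψ n]; rfl
  rw [e]; rfl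

theorem heisenberg_div_eq {a b : ℓ^∞(ℤ, ℝ)} (φ : position.domain) (t : ℝ) :
    ∃ ht : (φ : H) ∈ (heisenberg (jacobi a b) t).domain,
      ((t⁻¹ : ℝ) : ℂ) • heisenberg (jacobi a b) t ⟨φ, ht⟩
        = ((t⁻¹ : ℝ) : ℂ) • position φ + timeAverage (jacobi a b) (velocity a) t (φ : H) := by
  obtain ⟨ht, h⟩ := heisenberg_eq (a := a) (b := b) φ t
  exact ⟨ht, by rw [h, smul_add, timeAverage_apply]; rfl⟩

end Heisenberg

/-! ### Wronskians and a lower bound for eigenvalue gaps -/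

section Gap

open ComplexConjugate

/-- `u` solves the Jacobi difference equation at energy `c`. -/
def IsSolution (a b : ℤ → ℝ) (c : ℝ) (u : ℤ → ℂ) : Prop :=
  ∀ n : ℤ, (a (n - 1) : ℂ) * u (n - 1) + (b n : ℂ) * u n + (a n : ℂ) * u (n + 1) = (c : ℂ) * u n

/-- The recurrence can be solved for the next entry at the cost of a factor R, because a n ≥ R⁻¹.
The residual is allowed to be 2ε since `gap_bound` applies this to a combination whose residual
carries a coefficient of modulus at most 2; the energy bound 3R is the norm bound of the fibre
operators. -/
theorem norm_growth {R : ℝ} (hR : 1 ≤ R) {a b : ℤ → ℝ} (ha : ∀ n, R⁻¹ ≤ a n ∧ a n ≤ R)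
    (hb : ∀ n, |b n| ≤ R) {c : ℝ} (hc : |c| ≤ 3 * R) {w : ℤ → ℂ} {ε : ℝ} (hε : 0 ≤ ε)
    {q : ℕ} (hw : ∀ n : ℕ, n < q → ‖(a (n - 1) : ℂ) * w (n - 1) + (b n : ℂ) * w n + (a n : ℂ) * w (n + 1)
      - (c : ℂ) * w n‖ ≤ 2 * ε) :
    ∀ n : ℕ, n ≤ q → ‖w n‖ ≤ (8 * R ^ 2) ^ n * (‖w (-1)‖ + ‖w 0‖ + ε) := by
  -- Carrying two consecutive entries together with ε makes the inhomogeneous recursion homogeneous,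
  -- with factor 8R² per step.
  have key : ∀ n : ℕ, n ≤ q → ‖w ((n : ℤ) - 1)‖ + ‖w n‖ + ε
      ≤ (8 * R ^ 2) ^ n * (‖w (-1)‖ + ‖w 0‖ + ε) := by
    intro n hn
    induction n with
    | zero => simp
    | succ n ih =>
      replace ih := ih (by omega)
      have hwn := hw n (by omega)
      have h0 : 0 < a n := lt_of_lt_of_le (by positivity) (ha n).1
      have h1 : ‖(a n : ℂ) * w (n + 1)‖
          ≤ 2 * ε + (3 * R * ‖w n‖ + R * ‖w n‖) + R * ‖w ((n : ℤ) - 1)‖ := by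
        have e : (a n : ℂ) * w (n + 1)
            = ((a (n - 1) : ℂ) * w (n - 1) + (b n : ℂ) * w n + (a n : ℂ) * w (n + 1)
              - (c : ℂ) * w n) + ((c : ℂ) * w n - (b n : ℂ) * w n)
              - (a (n - 1) : ℂ) * w (n - 1) := by ring
        rw [e]
        refine (norm_sub_le _ _).trans (add_le_add ((norm_add_le _ _).trans (add_le_add hwn
          ((norm_sub_le _ _).trans (add_le_add ?_ ?_)))) ?_)
        · rw [norm_mul, Complex.norm_real]; exact mul_le_mul_of_nonneg_right hc (norm_nonneg _)
        · rw [norm_mul, Complex.norm_real]; exact mul_le_mul_of_nonneg_right (hb _) (norm_nonneg _)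
        · rw [norm_mul, Complex.norm_real, Real.norm_of_nonneg
            ((inv_nonneg.2 (by linarith)).trans (ha _).1)]
          exact mul_le_mul_of_nonneg_right (ha _).2 (norm_nonneg _)
      have h2 : R⁻¹ * ‖w (n + 1)‖ ≤ ‖(a n : ℂ) * w (n + 1)‖ := by
        rw [norm_mul, Complex.norm_real, Real.norm_of_nonneg h0.le]
        exact mul_le_mul_of_nonneg_right (ha _).1 (norm_nonneg _)
      have h3 : ‖w (n + 1)‖ ≤ R * (2 * ε + (3 * R * ‖w n‖ + R * ‖w n‖) + R * ‖w ((n : ℤ) - 1)‖) := by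
        have := mul_le_mul_of_nonneg_left (h2.trans h1) (by linarith : 0 ≤ R)
        rwa [← mul_assoc, mul_inv_cancel₀ (by linarith), one_mul] at this
      have hx := norm_nonneg (w n)
      have hy := norm_nonneg (w ((n : ℤ) - 1))
      have hRR : R ≤ R ^ 2 := by nlinarith
      push_cast
      rw [show ((n : ℤ) + 1 - 1) = n by ring, pow_succ', mul_assoc]
      refine le_trans ?_ (mul_le_mul_of_nonneg_left ih (by positivity))
      nlinarith [mul_le_mul_of_nonneg_right hRR hε, mul_le_mul_of_nonneg_right (hR.trans hRR) hε,
        mul_le_mul_of_nonneg_right (hR.trans hRR) hx, mul_nonneg (sq_nonneg R) hy]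
  intro n hn
  have := key n hn
  have hy := norm_nonneg (w ((n : ℤ) - 1))
  linarith

/-- Two orthogonal normalized Bloch solutions of the same quasi-momentum, which is not a band
edge, have energies that are at least exponentially separated. -/
theorem gap_bound {R : ℝ} (hR : 1 ≤ R) {a b : ℤ → ℝ} (ha : ∀ n, R⁻¹ ≤ a n ∧ a n ≤ R)
    (hb : ∀ n, |b n| ≤ R) {q : ℕ} (hq : 0 < q) (haq : ∀ n, a (n + q) = a n)
    {ζ : ℂ} (hζ : ‖ζ‖ = 1) {l m : ℝ} (hl : |l| ≤ 3 * R) (hm : |m| ≤ 3 * R) {u v : ℤ → ℂ}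
    (hu : IsSolution a b l u) (hv : IsSolution a b m v)
    (huq : ∀ n, u (n + q) = ζ * u n) (hvq : ∀ n, v (n + q) = ζ * v n)
    (hun : ∑ n ∈ Finset.range q, ‖u n‖ ^ 2 = 1) (hvn : ∑ n ∈ Finset.range q, ‖v n‖ ^ 2 = 1)
    (huv : ∑ n ∈ Finset.range q, conj (v n) * u n = 0) :
    ‖ζ ^ 2 - 1‖ ≤ 8 * R * q ^ 2 * (8 * R ^ 2) ^ (3 * q) * |l - m| := by
  have hR0 : 0 < R := by linarith
  set K : ℝ := 8 * R ^ 2 with hK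
  have hK1 : 1 ≤ K := by nlinarith
  have hbd : ∀ {x : ℤ → ℂ}, (∑ n ∈ Finset.range q, ‖x n‖ ^ 2 = 1) → ∀ n ∈ Finset.range q,
      ‖x n‖ ≤ 1 := by
    intro x hx n hn
    have := Finset.single_le_sum (f := fun n : ℕ => ‖x n‖ ^ 2) (fun i _ => sq_nonneg _) hn
    rw [hx] at this
    exact (sq_le_one_iff₀ (norm_nonneg _)).1 this
  -- The entry at -1 lies outside the period, but it has the modulus of the entry at q - 1 because
  -- |ζ| = 1.
  have hprev : ∀ {x : ℤ → ℂ}, (∀ n, x (n + q) = ζ * x n) →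
      (∑ n ∈ Finset.range q, ‖x n‖ ^ 2 = 1) → ‖x (-1)‖ ≤ 1 := by
    intro x hxq hx
    have h1 := hxq (-1)
    have h2 := hbd hx (q - 1) (Finset.mem_range.2 (by omega))
    rw [Nat.cast_sub hq, Nat.cast_one, show (q : ℤ) - 1 = -1 + q by ring, h1, norm_mul, hζ,
      one_mul] at h2
    exact h2
  have hu0 := hbd hun 0 (Finset.mem_range.2 hq)
  have hv0 := hbd hvn 0 (Finset.mem_range.2 hq)
  have hu1 := hprev huq hun
  have hv1 := hprev hvq hvn
  simp only [Nat.cast_zero] at hu0 hv0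
  -- the Wronskian
  set W : ℤ → ℂ := fun n => (a n : ℂ) * (v n * u (n + 1) - v (n + 1) * u n) with hW
  have hWd : ∀ n : ℤ, W n - W (n - 1) = ((l : ℂ) - m) * (v n * u n) := by
    intro n
    have h1 := hu n
    have h2 := hv n
    simp only [hW, sub_add_cancel]
    linear_combination v n * h1 - u n * h2
  have hWs : W (q - 1) - W (-1) = ((l : ℂ) - m) * ∑ n ∈ Finset.range q, v n * u n := by
    rw [Finset.mul_sum, ← Finset.sum_congr rfl (fun (n : ℕ) _ => hWd n)]
    have := Finset.sum_range_sub (fun n : ℕ => W ((n : ℤ) - 1)) q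
    simp only [Nat.cast_add, Nat.cast_one, add_sub_cancel_right, Nat.cast_zero, zero_sub] at this
    exact this.symm
  -- The Wronskian is bilinear, without conjugation, so each solution contributes a factor ζ. The
  -- band-edge condition is therefore ζ² = 1.
  have hWq : W (q - 1) = ζ ^ 2 * W (-1) := by
    have e1 : (q : ℤ) - 1 = -1 + q := by ring
    have e2 : (q : ℤ) - 1 + 1 = 0 + q := by ring
    simp only [hW]
    rw [e2, e1, haq, huq, hvq, huq, hvq]
    norm_num
    ring
  have hCS : ‖∑ n ∈ Finset.range q, v n * u n‖ ≤ 1 := by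
    refine (norm_sum_le _ _).trans ?_
    have : ∀ n ∈ Finset.range q, ‖v n * u n‖ ≤ (‖v n‖ ^ 2 + ‖u n‖ ^ 2) / 2 := by
      intro n _
      rw [norm_mul]
      nlinarith [sq_nonneg (‖v n‖ - ‖u n‖)]
    refine (Finset.sum_le_sum this).trans ?_
    rw [← Finset.sum_div, Finset.sum_add_distrib, hun, hvn]; norm_num
  have hW1 : ‖ζ ^ 2 - 1‖ * ‖W (-1)‖ ≤ |l - m| := by
    rw [← norm_mul, sub_mul, one_mul, ← hWq, hWs, norm_mul, ← Complex.ofReal_sub,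
      Complex.norm_real, Real.norm_eq_abs]
    exact mul_le_of_le_one_right (abs_nonneg _) hCS
  set D : ℂ := v (-1) * u 0 - v 0 * u (-1) with hD
  have hDW : R⁻¹ * ‖D‖ ≤ ‖W (-1)‖ := by
    have : W (-1) = (a (-1) : ℂ) * D := by simp [hW, hD]
    rw [this, norm_mul, Complex.norm_real]
    exact mul_le_mul_of_nonneg_right ((ha _).1.trans (le_abs_self _)) (norm_nonneg _)
  set Z := ‖ζ ^ 2 - 1‖ with hZ
  have hZ0 : 0 ≤ Z := norm_nonneg _
  have hZ2 : Z ≤ 2 := by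
    refine (norm_sub_le _ _).trans ?_
    rw [norm_pow, hζ]; norm_num
  -- D measures how far the initial data of u and v at the sites -1 and 0 are from being parallel;
  -- away from band edges it is controlled by the energy difference.
  have hZD : Z * ‖D‖ ≤ R * |l - m| := by
    have h1 := (mul_le_mul_of_nonneg_left hDW hZ0).trans hW1
    have h2 := mul_le_mul_of_nonneg_left h1 hR0.le
    calc Z * ‖D‖ = R * (Z * (R⁻¹ * ‖D‖)) := by field_simp
      _ ≤ _ := h2
  -- the part of `v` transversal to `u`
  set N : ℝ := ‖u (-1)‖ ^ 2 + ‖u 0‖ ^ 2 with hN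
  have hNc : (N : ℂ) = conj (u (-1)) * u (-1) + conj (u 0) * u 0 := by
    rw [Complex.conj_mul', Complex.conj_mul', hN]; push_cast; rfl
  set d : ℂ := conj (u (-1)) * v (-1) + conj (u 0) * v 0 with hd
  have hd2 : ‖d‖ ≤ 2 := by
    refine (norm_add_le _ _).trans ?_
    rw [norm_mul, norm_mul, RCLike.norm_conj, RCLike.norm_conj]
    nlinarith [norm_nonneg (u (-1)), norm_nonneg (v (-1)), norm_nonneg (u 0), norm_nonneg (v 0),
      mul_le_one₀ hu1 (norm_nonneg (v (-1))) hv1, mul_le_one₀ hu0 (norm_nonneg (v 0)) hv0]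
  set w : ℤ → ℂ := fun n => (N : ℂ) * v n - d * u n with hw
  -- On the sites -1 and 0, w is N times the component of v orthogonal to u in ℂ², whose entries are
  -- D times conjugated entries of u.
  have hwm : ‖w (-1)‖ ≤ ‖D‖ := by
    have : w (-1) = conj (u 0) * D := by simp only [hw, hNc, hd, hD]; ring
    rw [this, norm_mul, RCLike.norm_conj]
    exact mul_le_of_le_one_left (norm_nonneg _) hu0
  have hw0 : ‖w 0‖ ≤ ‖D‖ := by
    have : w 0 = -conj (u (-1)) * D := by simp only [hw, hNc, hd, hD]; ring
    rw [this, norm_mul, norm_neg, RCLike.norm_conj]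
    exact mul_le_of_le_one_left (norm_nonneg _) hu1
  -- At energy m, w solves the equation up to the residual -d(l - m)u.
  have hwg := norm_growth hR ha hb hm (abs_nonneg (l - m)) (w := w) (q := q) (fun n hn => by
    have h1 := hu n
    have h2 := hv n
    have e : (a (n - 1) : ℂ) * w (n - 1) + (b n : ℂ) * w n + (a n : ℂ) * w (n + 1)
      - (m : ℂ) * w n = -d * (((l - m : ℝ) : ℂ) * u n) + 0 := by
      simp only [hw]
      push_cast
      linear_combination (N : ℂ) * h2 - d * h1
    rw [e, add_zero, norm_mul, norm_neg, norm_mul, Complex.norm_real, Real.norm_eq_abs]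
    refine mul_le_mul hd2 ?_ (by positivity) (by norm_num)
    exact mul_le_of_le_one_right (abs_nonneg _) (hbd hun n (Finset.mem_range.2 hn)))
  have hug := norm_growth hR ha hb hl le_rfl (w := u) (q := q) (fun n _ => by
    rw [hu n]; simp)
  set B : ℝ := K ^ q with hB
  have hB0 : 0 ≤ B := by positivity
  have hKB : ∀ n < q, K ^ n ≤ B := fun n hn => pow_le_pow_right₀ hK1 hn.le
  set e : ℝ := 2 * ‖D‖ + |l - m| with he
  have he0 : 0 ≤ e := by positivity
  have hwn : ∀ n ∈ Finset.range q, ‖w n‖ ≤ B * e := fun n hn => by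
    have hn' := Finset.mem_range.1 hn
    refine (hwg n hn'.le).trans (mul_le_mul (hKB n hn') ?_ (by positivity) hB0)
    rw [he]; linarith
  have huN : ∀ n ∈ Finset.range q, ‖u n‖ ^ 2 ≤ B ^ 2 * (2 * N) := fun n hn => by
    have hn' := Finset.mem_range.1 hn
    have h1 := (hug n hn'.le).trans (mul_le_mul_of_nonneg_right (hKB n hn') (by positivity))
    have h2 := pow_le_pow_left₀ (norm_nonneg _) h1 2
    rw [mul_pow, add_zero] at h2
    refine h2.trans (mul_le_mul_of_nonneg_left ?_ (by positivity))
    nlinarith [sq_nonneg (‖u (-1)‖ - ‖u 0‖)]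
  -- A normalized solution cannot have too small initial data: growth over one period would leave
  -- its total mass below 1.
  have h1N : 1 ≤ q * (B ^ 2 * (2 * N)) := by
    have := Finset.sum_le_sum huN
    rwa [hun, Finset.sum_const, Finset.card_range, nsmul_eq_mul] at this
  -- Pairing w with v removes the multiple of u by orthogonality and leaves exactly N, so N is
  -- bounded by the size of w.
  have hNw : N ≤ q * (B * e) := by
    have h1 : ∑ n ∈ Finset.range q, conj (v n) * w n = N := by
      have : ∀ n ∈ Finset.range q, conj (v n) * w n
          = (N : ℂ) * ((‖v n‖ ^ 2 : ℝ) : ℂ) - d * (conj (v n) * u n) := by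
        intro n _
        push_cast
        rw [← Complex.conj_mul']
        simp only [hw]; ring
      rw [Finset.sum_congr rfl this, Finset.sum_sub_distrib, ← Finset.mul_sum, ← Finset.mul_sum,
        huv, ← Complex.ofReal_sum, hvn]
      simp
    have h2 : N = ‖∑ n ∈ Finset.range q, conj (v n) * w n‖ := by
      rw [h1, Complex.norm_real, Real.norm_of_nonneg (by positivity)]
    rw [h2]
    refine (norm_sum_le _ _).trans ?_
    have : ∀ n ∈ Finset.range q, ‖conj (v n) * w n‖ ≤ B * e := fun n hn => by
      rw [norm_mul, RCLike.norm_conj]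
      exact (mul_le_of_le_one_left (norm_nonneg _) (hbd hvn n hn)).trans (hwn n hn)
    refine (Finset.sum_le_sum this).trans_eq ?_
    rw [Finset.sum_const, Finset.card_range, nsmul_eq_mul]
  have hZe : Z * e ≤ 4 * R * |l - m| := by
    have := abs_nonneg (l - m)
    rw [he]
    nlinarith [mul_le_mul_of_nonneg_right hZ2 this, mul_le_mul_of_nonneg_right hR this]
  have h1e : 1 ≤ 2 * q ^ 2 * B ^ 3 * e := by
    refine h1N.trans ((mul_le_mul_of_nonneg_left (mul_le_mul_of_nonneg_left
      (mul_le_mul_of_nonneg_left hNw zero_le_two) (sq_nonneg B)) (Nat.cast_nonneg q)).trans_eq ?_)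
    ring
  calc Z = Z * 1 := (mul_one Z).symm
    _ ≤ Z * (2 * q ^ 2 * B ^ 3 * e) := mul_le_mul_of_nonneg_left h1e hZ0
    _ = 2 * q ^ 2 * B ^ 3 * (Z * e) := by ring
    _ ≤ 2 * q ^ 2 * B ^ 3 * (4 * R * |l - m|) := mul_le_mul_of_nonneg_left hZe (by positivity)
    _ = 8 * R * q ^ 2 * K ^ (3 * q) * |l - m| := by rw [hB]; ring

end Gap

/-! ### Self-adjointness of the Jacobi and velocity operators -/

section SelfAdjoint

open scoped InnerProductSpace

theorem star_shift (k : ℤ) : star (shift k) = shift (-k) := by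
  rw [ContinuousLinearMap.star_eq_adjoint, eq_comm, ContinuousLinearMap.eq_adjoint_iff]
  intro x y
  rw [lp.inner_eq_tsum, lp.inner_eq_tsum, ← (Equiv.addRight k).tsum_eq]
  simp

theorem star_diag (c : ℓ^∞(ℤ, ℝ)) : star (diag c) = diag c := by
  rw [ContinuousLinearMap.star_eq_adjoint, eq_comm, ContinuousLinearMap.eq_adjoint_iff]
  intro x y
  rw [lp.inner_eq_tsum, lp.inner_eq_tsum]
  congr 1
  ext n
  simp
  ring

theorem jacobi_eq_mul (a b : ℓ^∞(ℤ, ℝ)) :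
    jacobi a b = shift (-1) * diag a + diag b + diag a * shift 1 := rfl

theorem velocity_eq_mul (a : ℓ^∞(ℤ, ℝ)) :
    velocity a = Complex.I • (diag a * shift 1 - shift (-1) * diag a) := rfl

theorem isSelfAdjoint_jacobi (a b : ℓ^∞(ℤ, ℝ)) : IsSelfAdjoint (jacobi a b) := by
  rw [IsSelfAdjoint, jacobi_eq_mul]
  simp only [star_add, star_mul, star_shift, star_diag, neg_neg]
  abel

theorem isSelfAdjoint_velocity (a : ℓ^∞(ℤ, ℝ)) : IsSelfAdjoint (velocity a) := by
  rw [IsSelfAdjoint, velocity_eq_mul]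
  simp only [star_smul, star_sub, star_mul, star_shift, star_diag, neg_neg, RCLike.star_def,
    Complex.conj_I]
  rw [neg_smul, ← smul_neg, neg_sub]

end SelfAdjoint

/-! ### The same operators on ℓ¹(ℤ) -/

section SummableSequences

/-- The Banach space `ℓ¹(ℤ)`. -/
abbrev L1 : Type := lp (fun _ : ℤ => ℂ) 1

theorem summable_norm_L1 (ψ : L1) : Summable fun n => ‖ψ n‖ := by
  simpa using (memℓp_gen_iff (p := 1) (by norm_num)).1 (lp.memℓp ψ)

theorem norm_L1 (ψ : L1) : ‖ψ‖ = ∑' n, ‖ψ n‖ := by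
  rw [lp.norm_eq_tsum_rpow (by norm_num)]
  simp

theorem memlp_one_of_summable {f : ℤ → ℂ} (hf : Summable fun n => ‖f n‖) : Memℓp f 1 :=
  (memℓp_gen_iff (by norm_num)).2 (by simpa using hf)

/-- The translation on `ℓ¹(ℤ)`. -/
def shiftL1 (k : ℤ) : L1 →L[ℂ] L1 :=
  LinearMap.mkContinuous
    { toFun := fun φ => ⟨fun n => φ (n + k), memlp_one_of_summable
        ((Equiv.addRight k).summable_iff.2 (summable_norm_L1 φ))⟩
      map_add' := fun φ ψ => by ext n; rfl
      map_smul' := fun c φ => by ext n; simp }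
    1 (fun φ => by
      rw [one_mul, norm_L1, norm_L1]
      exact le_of_eq ((Equiv.addRight k).tsum_eq (fun n : ℤ => ‖φ n‖)))

@[simp] theorem shiftL1_apply (k : ℤ) (φ : L1) (n : ℤ) : shiftL1 k φ n = φ (n + k) := rfl

theorem norm_coeff_mul_le (c : ℓ^∞(ℤ, ℝ)) (φ : L1) (n : ℤ) :
    ‖(c n : ℂ) * φ n‖ ≤ ‖c‖ * ‖φ n‖ := by
  rw [norm_mul, Complex.norm_real]
  exact mul_le_mul_of_nonneg_right (lp.norm_apply_le_norm (by simp) c n) (norm_nonneg _)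

theorem summable_coeff_mul (c : ℓ^∞(ℤ, ℝ)) (φ : L1) : Summable fun n => ‖(c n : ℂ) * φ n‖ :=
  Summable.of_nonneg_of_le (fun _ => norm_nonneg _) (norm_coeff_mul_le c φ)
    ((summable_norm_L1 φ).mul_left _)

/-- Multiplication by a bounded real sequence on `ℓ¹(ℤ)`. -/
def diagL1 (c : ℓ^∞(ℤ, ℝ)) : L1 →L[ℂ] L1 :=
  LinearMap.mkContinuous
    { toFun := fun φ => ⟨fun n => (c n : ℂ) * φ n, memlp_one_of_summable (summable_coeff_mul c φ)⟩
      map_add' := fun φ ψ => by ext n; exact mul_add _ _ _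
      map_smul' := fun z φ => by ext n; simp [mul_left_comm] }
    ‖c‖ (fun φ => by
      rw [norm_L1, norm_L1, ← tsum_mul_left]
      exact (summable_coeff_mul c φ).tsum_le_tsum (norm_coeff_mul_le c φ)
        ((summable_norm_L1 φ).mul_left _))

@[simp] theorem diagL1_apply (c : ℓ^∞(ℤ, ℝ)) (φ : L1) (n : ℤ) :
    diagL1 c φ n = (c n : ℂ) * φ n := rfl

theorem norm_sq_H (φ : H) : ‖φ‖ ^ 2 = ∑' n, ‖φ n‖ ^ 2 := by
  have := lp.norm_rpow_eq_tsum (p := 2) (by norm_num) φ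
  simpa using this

/-- The inclusion of `ℓ¹(ℤ)` into `ℓ²(ℤ)`. -/
def inclusion : L1 →L[ℂ] H :=
  LinearMap.mkContinuous (lp.linearMapOfLE ℂ (fun _ : ℤ => ℂ) (by norm_num)) 1 (fun φ => by
    rw [one_mul]
    refine (sq_le_sq₀ (norm_nonneg _) (norm_nonneg _)).1 ?_
    have h : ∀ n, ‖φ n‖ ^ 2 ≤ ‖φ‖ * ‖φ n‖ := fun n => by
      rw [sq]
      exact mul_le_mul_of_nonneg_right (lp.norm_apply_le_norm (by norm_num) φ n) (norm_nonneg _)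
    rw [norm_sq_H, sq, norm_L1 φ, ← tsum_mul_left, ← norm_L1]
    have hs := (summable_norm_L1 φ).mul_left ‖φ‖
    exact (Summable.of_nonneg_of_le (fun _ => sq_nonneg _) h hs).tsum_le_tsum h hs)

@[simp] theorem inclusion_apply (φ : L1) (n : ℤ) : inclusion φ n = φ n := rfl

/-- The Jacobi operator on `ℓ¹(ℤ)`. -/
def jacobiL1 (a b : ℓ^∞(ℤ, ℝ)) : L1 →L[ℂ] L1 :=
  shiftL1 (-1) * diagL1 a + diagL1 b + diagL1 a * shiftL1 1

/-- The velocity operator on `ℓ¹(ℤ)`. -/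
def velocityL1 (a : ℓ^∞(ℤ, ℝ)) : L1 →L[ℂ] L1 :=
  Complex.I • (diagL1 a * shiftL1 1 - shiftL1 (-1) * diagL1 a)

theorem inclusion_jacobi (a b : ℓ^∞(ℤ, ℝ)) :
    inclusion ∘L jacobiL1 a b = jacobi a b ∘L inclusion := by
  ext1 φ
  ext n
  simp only [ContinuousLinearMap.comp_apply, inclusion_apply, jacobi_apply, jacobiL1, add_apply,
    mul_apply_eq_comp, lp.coeFn_add, Pi.add_apply, shiftL1_apply, diagL1_apply, ← sub_eq_add_neg]

theorem inclusion_velocity (a : ℓ^∞(ℤ, ℝ)) :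
    inclusion ∘L velocityL1 a = velocity a ∘L inclusion := by
  ext1 φ
  ext n
  simp only [ContinuousLinearMap.comp_apply, inclusion_apply, velocity_eq_mul, velocityL1,
    smul_apply, sub_apply, mul_apply_eq_comp, lp.coeFn_smul, Pi.smul_apply, lp.coeFn_sub,
    Pi.sub_apply, shiftL1_apply, diagL1_apply, shift_apply, diag_apply]

end SummableSequences

/-! ### Fibre operators on ℂ^q -/

section Fiber

open scoped InnerProductSpace

variable {q : ℕ} [NeZero q]

/-- The fibre `ℂ^q` of the Bloch decomposition, indexed by residues modulo `q`. -/
abbrev Fiber (q : ℕ) : Type := EuclideanSpace ℂ (ZMod q)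

/-- The translation on the fibre. -/
def fiberShift (k : ZMod q) : Fiber q →L[ℂ] Fiber q :=
  (LinearIsometryEquiv.piLpCongrLeft 2 ℂ ℂ (Equiv.subRight k)).toContinuousLinearEquiv

@[simp] theorem fiberShift_apply (k : ZMod q) (p : Fiber q) (m : ZMod q) :
    fiberShift k p m = p (m + k) := rfl

theorem norm_fiberShift (k : ZMod q) (p : Fiber q) : ‖fiberShift k p‖ = ‖p‖ :=
  (LinearIsometryEquiv.piLpCongrLeft 2 ℂ ℂ (Equiv.subRight k)).norm_map p

/-- Multiplication by a real function on the fibre. -/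
def fiberDiag (c : ZMod q → ℝ) : Fiber q →L[ℂ] Fiber q :=
  LinearMap.toContinuousLinearMap
    { toFun := fun p => WithLp.toLp 2 fun m => (c m : ℂ) * p m
      map_add' := fun p r => by ext m; simp [mul_add]
      map_smul' := fun z p => by ext m; simp [mul_left_comm] }

@[simp] theorem fiberDiag_apply (c : ZMod q → ℝ) (p : Fiber q) (m : ZMod q) :
    fiberDiag c p m = (c m : ℂ) * p m := rfl

theorem norm_fiberDiag_le {c : ZMod q → ℝ} {B : ℝ} (hB : 0 ≤ B) (hc : ∀ m, |c m| ≤ B)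
    (p : Fiber q) : ‖fiberDiag c p‖ ≤ B * ‖p‖ := by
  refine (sq_le_sq₀ (norm_nonneg _) (by positivity)).1 ?_
  rw [mul_pow, EuclideanSpace.norm_sq_eq, EuclideanSpace.norm_sq_eq, Finset.mul_sum]
  refine Finset.sum_le_sum fun m _ => ?_
  rw [fiberDiag_apply, norm_mul, mul_pow, Complex.norm_real]
  exact mul_le_mul_of_nonneg_right (pow_le_pow_left₀ (norm_nonneg _) (hc m) 2) (sq_nonneg _)

theorem star_fiberShift (k : ZMod q) : star (fiberShift k) = fiberShift (-k) := by
  rw [ContinuousLinearMap.star_eq_adjoint, eq_comm, ContinuousLinearMap.eq_adjoint_iff]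
  intro x y
  rw [PiLp.inner_apply, PiLp.inner_apply, ← Equiv.sum_comp (Equiv.addRight k)]
  simp

theorem star_fiberDiag (c : ZMod q → ℝ) : star (fiberDiag c) = fiberDiag c := by
  rw [ContinuousLinearMap.star_eq_adjoint, eq_comm, ContinuousLinearMap.eq_adjoint_iff]
  intro x y
  rw [PiLp.inner_apply, PiLp.inner_apply]
  refine Finset.sum_congr rfl fun m _ => ?_
  simp
  ring

/-- The phase `e^{iθ}`. -/
def phase (θ : ℝ) : ℂ := Complex.exp (Complex.I * θ)

theorem norm_phase (θ : ℝ) : ‖phase θ‖ = 1 := by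
  rw [phase, mul_comm]; exact Complex.norm_exp_ofReal_mul_I θ

theorem conj_phase (θ : ℝ) : (starRingEnd ℂ) (phase θ) = phase (-θ) := by
  simp [phase, ← Complex.exp_conj]

theorem phase_add (θ η : ℝ) : phase (θ + η) = phase θ * phase η := by
  rw [phase, phase, phase, ← Complex.exp_add]; push_cast; ring_nf

@[simp] theorem phase_zero : phase 0 = 1 := by simp [phase]

/-- The fibre at quasi-momentum `θ` of a periodic Jacobi operator. -/
def fiberJacobi (a b : ZMod q → ℝ) (θ : ℝ) : Fiber q →L[ℂ] Fiber q :=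
  phase (-θ) • (fiberShift (-1) * fiberDiag a) + fiberDiag b
    + phase θ • (fiberDiag a * fiberShift 1)

/-- The fibre at quasi-momentum `θ` of the velocity operator. -/
def fiberVelocity (a : ZMod q → ℝ) (θ : ℝ) : Fiber q →L[ℂ] Fiber q :=
  Complex.I • (phase θ • (fiberDiag a * fiberShift 1)
    - phase (-θ) • (fiberShift (-1) * fiberDiag a))

theorem isSelfAdjoint_of_star_pair {E : Type*} [NormedAddCommGroup E] [InnerProductSpace ℂ E]
    [CompleteSpace E] {S S' A B : E →L[ℂ] E} {z z' : ℂ} (hS : star S = S') (hA : star A = A)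
    (hB : star B = B) (hz : (starRingEnd ℂ) z = z') :
    IsSelfAdjoint (z' • (S' * A) + B + z • (A * S)) := by
  rw [IsSelfAdjoint, ← hS, ← hz]
  simp only [star_add, star_smul, star_mul, star_star, hA, hB, RCLike.star_def, RCLike.conj_conj]
  abel

theorem isSelfAdjoint_fiberJacobi (a b : ZMod q → ℝ) (θ : ℝ) :
    IsSelfAdjoint (fiberJacobi a b θ) := by
  exact isSelfAdjoint_of_star_pair (star_fiberShift (1 : ZMod q)) (star_fiberDiag a)
    (star_fiberDiag b) (conj_phase θ)

theorem norm_fiberJacobi_le {a b : ZMod q → ℝ} {R : ℝ} (hR : 0 ≤ R) (ha : ∀ m, |a m| ≤ R)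
    (hb : ∀ m, |b m| ≤ R) (θ : ℝ) (p : Fiber q) : ‖fiberJacobi a b θ p‖ ≤ 3 * R * ‖p‖ := by
  have h1 : ‖phase (-θ) • fiberShift (-1) (fiberDiag a p)‖ ≤ R * ‖p‖ := by
    rw [norm_smul, norm_phase, one_mul, norm_fiberShift]
    exact norm_fiberDiag_le hR ha p
  have h2 : ‖phase θ • fiberDiag a (fiberShift 1 p)‖ ≤ R * ‖p‖ := by
    rw [norm_smul, norm_phase, one_mul]
    exact (norm_fiberDiag_le hR ha _).trans_eq (by rw [norm_fiberShift])
  calc _ ≤ R * ‖p‖ + R * ‖p‖ + R * ‖p‖ := (norm_add_le _ _).trans (add_le_add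
          ((norm_add_le _ _).trans (add_le_add h1 (norm_fiberDiag_le hR hb p))) h2)
    _ = _ := by ring

theorem norm_fiberVelocity_le {a : ZMod q → ℝ} {R : ℝ} (hR : 0 ≤ R) (ha : ∀ m, |a m| ≤ R)
    (θ : ℝ) : ‖fiberVelocity a θ‖ ≤ 2 * R := by
  refine ContinuousLinearMap.opNorm_le_bound _ (by positivity) fun p => ?_
  have h1 : ‖phase (-θ) • fiberShift (-1) (fiberDiag a p)‖ ≤ R * ‖p‖ := by
    rw [norm_smul, norm_phase, one_mul, norm_fiberShift]
    exact norm_fiberDiag_le hR ha p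
  have h2 : ‖phase θ • fiberDiag a (fiberShift 1 p)‖ ≤ R * ‖p‖ := by
    rw [norm_smul, norm_phase, one_mul]
    exact (norm_fiberDiag_le hR ha _).trans_eq (by rw [norm_fiberShift])
  have h3 : fiberVelocity a θ p = Complex.I • (phase θ • fiberDiag a (fiberShift 1 p)
    - phase (-θ) • fiberShift (-1) (fiberDiag a p)) := rfl
  rw [h3, norm_smul, Complex.norm_I, one_mul]
  calc _ ≤ R * ‖p‖ + R * ‖p‖ := (norm_sub_le _ _).trans (add_le_add h2 h1)
    _ = _ := by ring

end Fiber

/-! ### The Bloch transform on ℓ¹(ℤ) -/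

section Bloch

variable {q : ℕ} [NeZero q]

/-- The pairing of `ℓ¹(ℤ)` with a bounded sequence of weights. -/
def pairing (w : ℤ → ℂ) (hw : ∀ n, ‖w n‖ ≤ 1) : L1 →L[ℂ] ℂ :=
  have hs : ∀ ψ : L1, Summable fun n => ‖w n * ψ n‖ := fun ψ =>
    Summable.of_nonneg_of_le (fun _ => norm_nonneg _) (fun n => by
      rw [norm_mul]; exact mul_le_of_le_one_left (norm_nonneg _) (hw n)) (summable_norm_L1 ψ)
  LinearMap.mkContinuous
    { toFun := fun ψ => ∑' n, w n * ψ n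
      map_add' := fun ψ χ => by
        rw [← (hs ψ).of_norm.tsum_add (hs χ).of_norm]
        simp [mul_add]
      map_smul' := fun c ψ => by
        rw [RingHom.id_apply, smul_eq_mul, ← tsum_mul_left]
        simp [mul_left_comm] }
    1 (fun ψ => by
      rw [one_mul, norm_L1]
      refine (norm_tsum_le_tsum_norm (hs ψ)).trans ((hs ψ).tsum_le_tsum (fun n => ?_)
        (summable_norm_L1 ψ))
      rw [norm_mul]; exact mul_le_of_le_one_left (norm_nonneg _) (hw n))

/-- The weights of the Bloch transform. -/
def blochWeight (θ : ℝ) (m : ZMod q) (n : ℤ) : ℂ := if (n : ZMod q) = m then phase (-(θ * n)) else 0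

omit [NeZero q] in
theorem norm_blochWeight_le (θ : ℝ) (m : ZMod q) (n : ℤ) : ‖blochWeight θ m n‖ ≤ 1 := by
  unfold blochWeight
  split_ifs
  · rw [norm_phase]
  · simp

/-- The Bloch transform at quasi-momentum `θ`. -/
def bloch (θ : ℝ) : L1 →L[ℂ] Fiber q :=
  ((EuclideanSpace.equiv (ZMod q) ℂ).symm : (ZMod q → ℂ) →L[ℂ] Fiber q) ∘L
    ContinuousLinearMap.pi fun m => pairing (blochWeight θ m) (norm_blochWeight_le θ m)

omit [NeZero q] in
theorem bloch_apply (θ : ℝ) (ψ : L1) (m : ZMod q) :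
    bloch θ ψ m = ∑' n, blochWeight θ m n * ψ n := rfl

theorem bloch_shift (θ : ℝ) (k : ℤ) (ψ : L1) :
    bloch (q := q) θ (shiftL1 k ψ) = phase (θ * k) • fiberShift (k : ZMod q) (bloch θ ψ) := by
  ext m
  rw [PiLp.smul_apply, fiberShift_apply, bloch_apply, bloch_apply, smul_eq_mul, ← tsum_mul_left,
    ← (Equiv.subRight k).tsum_eq]
  congr 1
  ext n
  simp only [Equiv.subRight_apply, shiftL1_apply, sub_add_cancel, blochWeight, Int.cast_sub,
    sub_eq_iff_eq_add]
  split_ifs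
  · rw [← mul_assoc, ← phase_add]
    congr 2
    ring
  · simp

theorem bloch_diag (θ : ℝ) {c : ℓ^∞(ℤ, ℝ)} {c' : ZMod q → ℝ} (hc : ∀ n : ℤ, c' n = c n) (ψ : L1) :
    bloch (q := q) θ (diagL1 c ψ) = fiberDiag c' (bloch θ ψ) := by
  ext m
  rw [fiberDiag_apply, bloch_apply, bloch_apply, ← tsum_mul_left]
  congr 1
  ext n
  simp only [diagL1_apply, blochWeight]
  split_ifs with h
  · rw [← h, hc]; ring
  · simp

theorem bloch_jacobi (θ : ℝ) {a b : ℓ^∞(ℤ, ℝ)} {a' b' : ZMod q → ℝ} (ha : ∀ n : ℤ, a' n = a n)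
    (hb : ∀ n : ℤ, b' n = b n) :
    bloch (q := q) θ ∘L jacobiL1 a b = fiberJacobi a' b' θ ∘L bloch θ := by
  ext1 ψ
  simp only [ContinuousLinearMap.comp_apply, jacobiL1, fiberJacobi, add_apply, smul_apply,
    mul_apply_eq_comp, map_add, bloch_shift, bloch_diag θ ha, bloch_diag θ hb, map_smul]
  simp

theorem bloch_velocity (θ : ℝ) {a : ℓ^∞(ℤ, ℝ)} {a' : ZMod q → ℝ} (ha : ∀ n : ℤ, a' n = a n) :
    bloch (q := q) θ ∘L velocityL1 a = fiberVelocity a' θ ∘L bloch θ := by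
  ext1 ψ
  simp only [ContinuousLinearMap.comp_apply, velocityL1, fiberVelocity, sub_apply, smul_apply,
    mul_apply_eq_comp, map_sub, bloch_shift, bloch_diag θ ha, map_smul]
  simp

omit [NeZero q] in
theorem continuous_phase : Continuous phase := by
  unfold phase; fun_prop

omit [NeZero q] in
theorem continuous_bloch (ψ : L1) (m : ZMod q) : Continuous fun θ : ℝ => bloch θ ψ m := by
  simp only [bloch_apply]
  refine continuous_tsum (fun n => ?_) (summable_norm_L1 ψ) (fun n θ => ?_)
  · refine Continuous.mul ?_ continuous_const
    unfold blochWeight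
    split_ifs
    · exact continuous_phase.comp (by fun_prop)
    · exact continuous_const
  · rw [norm_mul]
    exact mul_le_of_le_one_left (norm_nonneg _) (norm_blochWeight_le θ m n)

/-- A point mass has a fibre of unit norm at every quasi-momentum, so a fibrewise bound for unit
vectors can be integrated over θ without a weight. This is what makes unit vectors the natural test
vectors. -/
theorem norm_bloch_single (θ : ℝ) (n : ℤ) : ‖bloch (q := q) θ (lp.single 1 n 1)‖ = 1 := by
  have : bloch (q := q) θ (lp.single 1 n 1)
      = EuclideanSpace.single (n : ZMod q) (phase (-(θ * n))) := by
    ext m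
    rw [bloch_apply, tsum_eq_single n]
    · simp [blochWeight, eq_comm]
    · intro k hk
      simp [lp.single_apply, hk]
  rw [this, PiLp.norm_single, norm_phase]

end Bloch

/-! ### Parseval identity for the Bloch transform -/

section Parseval

open ComplexConjugate

theorem integral_phase_mul_int (j : ℤ) :
    ∫ θ in (0 : ℝ)..(2 * Real.pi), phase (θ * j) = if j = 0 then ((2 * Real.pi : ℝ) : ℂ) else 0 := by
  split_ifs with h
  · simp [h]
  · have hc : Complex.I * (j : ℂ) ≠ 0 := mul_ne_zero Complex.I_ne_zero (Int.cast_ne_zero.2 h)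
    have e : ∀ θ : ℝ, phase (θ * j) = Complex.exp (Complex.I * (j : ℂ) * θ) := fun θ => by
      rw [phase]; push_cast; ring_nf
    simp only [e]
    rw [integral_exp_mul_complex hc]
    have : Complex.exp (Complex.I * (j : ℂ) * ((2 * Real.pi : ℝ) : ℂ)) = 1 := by
      rw [← Complex.exp_int_mul_two_pi_mul_I j]
      congr 1
      push_cast; ring
    rw [this]; simp

theorem hasSum_integral_of_summable_bound {F : ℤ → ℝ → ℂ} {f : ℝ → ℂ} {B : ℤ → ℝ}
    (hF : ∀ n, Continuous (F n)) (hB : ∀ n t, ‖F n t‖ ≤ B n) (hs : Summable B)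
    (hf : ∀ t, HasSum (fun n => F n t) (f t)) (x y : ℝ) :
    HasSum (fun n => ∫ t in x..y, F n t) (∫ t in x..y, f t) :=
  intervalIntegral.hasSum_integral_of_dominated_convergence (fun n _ => B n)
    (fun n => (hF n).aestronglyMeasurable) (fun n => Eventually.of_forall fun t _ => hB n t)
    (Eventually.of_forall fun _ _ => hs) intervalIntegrable_const
    (Eventually.of_forall fun t _ => hf t)

/-- Absolute summability gives dominated convergence: each coefficient is recovered by integrating
against a phase, and then one factor of |f|² = conj f · f is expanded termwise. -/
theorem parseval {c : ℤ → ℂ} (hc : Summable fun n => ‖c n‖) :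
    ∫ θ in (0 : ℝ)..(2 * Real.pi), ‖∑' n : ℤ, phase (-(θ * n)) * c n‖ ^ 2
      = 2 * Real.pi * ∑' n, ‖c n‖ ^ 2 := by
  set f : ℝ → ℂ := fun θ => ∑' n : ℤ, phase (-(θ * n)) * c n with hf
  have hn : ∀ (θ : ℝ) (n : ℤ), ‖phase (-(θ * n)) * c n‖ ≤ ‖c n‖ := fun θ n => by
    rw [norm_mul, norm_phase, one_mul]
  have hcn : ∀ n : ℤ, Continuous fun θ : ℝ => phase (-(θ * n)) * c n := fun n =>
    (continuous_phase.comp (by fun_prop)).mul continuous_const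
  have hfs : ∀ θ, HasSum (fun n : ℤ => phase (-(θ * n)) * c n) (f θ) := fun θ =>
    (Summable.of_norm_bounded hc (hn θ)).hasSum
  have hfc : Continuous f := continuous_tsum hcn hc (fun n θ => hn θ n)
  have hfb : ∀ θ, ‖f θ‖ ≤ ∑' n, ‖c n‖ := fun θ => tsum_of_norm_bounded hc.hasSum (hn θ)
  have hcoef : ∀ k : ℤ, ∫ θ in (0 : ℝ)..(2 * Real.pi), phase (θ * k) * f θ
      = ((2 * Real.pi : ℝ) : ℂ) * c k := by
    intro k
    have h1 := hasSum_integral_of_summable_bound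
      (F := fun n θ => phase (θ * k) * (phase (-(θ * n)) * c n)) (B := fun n => ‖c n‖)
      (fun n => (continuous_phase.comp (by fun_prop)).mul (hcn n))
      (fun n θ => by rw [norm_mul, norm_phase, one_mul]; exact hn θ n) hc
      (fun θ => (hfs θ).mul_left _) 0 (2 * Real.pi)
    have h2 : ∀ n : ℤ, ∫ θ in (0 : ℝ)..(2 * Real.pi), phase (θ * k) * (phase (-(θ * n)) * c n)
        = if n = k then ((2 * Real.pi : ℝ) : ℂ) * c k else 0 := by
      intro n
      have e : ∀ θ : ℝ, phase (θ * k) * (phase (-(θ * n)) * c n)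
          = phase (θ * ((k - n : ℤ) : ℝ)) * c n := fun θ => by
        rw [← mul_assoc, ← phase_add]; congr 2; push_cast; ring
      simp only [e]
      rw [intervalIntegral.integral_mul_const, integral_phase_mul_int]
      by_cases h : n = k
      · simp [h]
      · rw [if_neg h, if_neg (by omega), zero_mul]
    simp only [h2] at h1
    exact h1.unique (hasSum_ite_eq k _)
  have h3 := hasSum_integral_of_summable_bound
    (F := fun (n : ℤ) θ => conj (phase (-(θ * n)) * c n) * f θ)
    (B := fun n => ‖c n‖ * ∑' n, ‖c n‖) (f := fun θ => conj (f θ) * f θ)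
    (fun n => (Complex.continuous_conj.comp (hcn n)).mul hfc)
    (fun n θ => by
      rw [norm_mul, RCLike.norm_conj]
      exact mul_le_mul (hn θ n) (hfb θ) (norm_nonneg _) (norm_nonneg _))
    (hc.mul_right _)
    (fun θ => by
      have h := (Complex.hasSum_conj'.2 (by simpa using hfs θ) : HasSum
        (fun n : ℤ => conj (phase (-(θ * n)) * c n)) (conj (f θ)))
      exact h.mul_right _) 0 (2 * Real.pi)
  have h4 : ∀ n : ℤ, ∫ θ in (0 : ℝ)..(2 * Real.pi), conj (phase (-(θ * n)) * c n) * f θ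
      = ((2 * Real.pi * ‖c n‖ ^ 2 : ℝ) : ℂ) := by
    intro n
    have e : ∀ θ : ℝ, conj (phase (-(θ * n)) * c n) * f θ
        = conj (c n) * (phase (θ * n) * f θ) := fun θ => by
      rw [map_mul, conj_phase, neg_neg]; ring
    simp only [e]
    rw [intervalIntegral.integral_const_mul, hcoef]
    push_cast
    rw [← Complex.conj_mul']; ring
  simp only [h4] at h3
  have h5 : ∀ θ, conj (f θ) * f θ = ((‖f θ‖ ^ 2 : ℝ) : ℂ) := fun θ => by
    rw [Complex.conj_mul']; push_cast; rfl
  simp only [h5] at h3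
  rw [intervalIntegral.integral_ofReal] at h3
  have h6 := (Complex.hasSum_ofReal.1 h3).tsum_eq
  rw [← h6, tsum_mul_left]

/-- Each component is a Fourier series supported on one residue class, and these classes partition
ℤ. Integrating over the full circle, rather than a reduced Brillouin zone, avoids any factor q. -/
theorem integral_norm_bloch_sq {q : ℕ} [NeZero q] (ψ : L1) :
    ∫ θ in (0 : ℝ)..(2 * Real.pi), ‖bloch (q := q) θ ψ‖ ^ 2
      = 2 * Real.pi * ‖inclusion ψ‖ ^ 2 := by
  set c : ZMod q → ℤ → ℂ := fun m n => if (n : ZMod q) = m then ψ n else 0 with hc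
  have hcs : ∀ m, Summable fun n => ‖c m n‖ := fun m =>
    Summable.of_nonneg_of_le (fun _ => norm_nonneg _) (fun n => by
      simp only [hc]; split_ifs <;> simp) (summable_norm_L1 ψ)
  have hcs2 : ∀ m, Summable fun n => ‖c m n‖ ^ 2 := fun m => by
    refine Summable.of_nonneg_of_le (fun _ => sq_nonneg _) (fun n => ?_)
      ((summable_norm_L1 ψ).mul_left ‖ψ‖)
    simp only [hc]
    split_ifs
    · rw [sq]
      exact mul_le_mul_of_nonneg_right (lp.norm_apply_le_norm (by norm_num) ψ n) (norm_nonneg _)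
    · simp; positivity
  have e : ∀ (θ : ℝ) (m : ZMod q), bloch θ ψ m = ∑' n : ℤ, phase (-(θ * n)) * c m n := by
    intro θ m
    rw [bloch_apply]
    congr 1
    ext n
    simp only [blochWeight, hc]
    split_ifs <;> simp
  simp only [EuclideanSpace.norm_sq_eq]
  rw [intervalIntegral.integral_finsetSum (f := fun m θ => ‖bloch θ ψ m‖ ^ 2)
    (fun m _ => ((continuous_bloch ψ m).norm.pow 2).intervalIntegrable _ _)]
  simp only [e]
  rw [Finset.sum_congr rfl fun m _ => parseval (hcs m), ← Finset.mul_sum,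
    ← Summable.tsum_finsetSum fun m _ => hcs2 m, norm_sq_H]
  congr 2
  ext n
  rw [Finset.sum_eq_single (n : ZMod q)]
  · simp [hc]
  · intro m _ hm
    simp [hc, hm.symm]
  · simp

end Parseval

/-! ### A Lorentzian integral -/

section LorentzIntegral

/-- Rescaling by q gives 2q periods of length π and a Jacobian 1/q, so q drops out. On the central
period |sin x| ≥ (2/π)|x| reduces the integral to an arctangent. -/
theorem integral_lorentz_le {c : ℝ} (hc : 0 < c) {q : ℕ} (hq : 0 < q) :
    ∫ θ in (0 : ℝ)..(2 * Real.pi), (1 + (c * Real.sin (q * θ)) ^ 2)⁻¹ ≤ Real.pi ^ 2 / c := by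
  set h : ℝ → ℝ := fun x => (1 + (c * Real.sin x) ^ 2)⁻¹ with hh
  have hcont : Continuous h :=
    Continuous.inv₀ (by fun_prop) (fun x => by positivity)
  have hper : Function.Periodic h Real.pi := fun x => by
    simp only [hh, Real.sin_add_pi, mul_neg, neg_sq]
  have hq' : (q : ℝ) ≠ 0 := by positivity
  have h1 : ∫ θ in (0 : ℝ)..(2 * Real.pi), h (q * θ)
      = (q : ℝ)⁻¹ * ∫ x in (0 : ℝ)..(q * (2 * Real.pi)), h x := by
    rw [intervalIntegral.integral_comp_mul_left h hq', mul_zero, smul_eq_mul]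
  have h2 : ∫ x in (0 : ℝ)..(q * (2 * Real.pi)), h x
      = (2 * q) * ∫ x in (-(Real.pi / 2))..(Real.pi / 2), h x := by
    have := hper.intervalIntegral_add_zsmul_eq (2 * q : ℤ) 0
      (fun _ _ => hcont.intervalIntegrable _ _)
    rw [hper.intervalIntegral_add_eq 0 (-(Real.pi / 2))] at this
    simp only [zsmul_eq_mul, zero_add] at this
    rw [show (-(Real.pi / 2) + Real.pi) = Real.pi / 2 by ring] at this
    push_cast at this
    rw [← this]
    congr 1; ring
  set k : ℝ := 2 * c / Real.pi with hk
  have hk0 : 0 < k := by positivity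
  have hcont' : Continuous fun x : ℝ => (1 + (k * x) ^ 2)⁻¹ :=
    Continuous.inv₀ (by fun_prop) (fun x => by positivity)
  have h3 : ∫ x in (-(Real.pi / 2))..(Real.pi / 2), h x
      ≤ ∫ x in (-(Real.pi / 2))..(Real.pi / 2), (1 + (k * x) ^ 2)⁻¹ := by
    refine intervalIntegral.integral_mono_on (by linarith [Real.pi_pos])
      (hcont.intervalIntegrable _ _) (hcont'.intervalIntegrable _ _) (fun x hx => ?_)
    have hx' : |x| ≤ Real.pi / 2 := abs_le.2 hx
    have hs := Real.mul_abs_le_abs_sin hx'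
    refine inv_anti₀ (by positivity) (add_le_add_right ?_ 1)
    refine sq_le_sq.2 ?_
    rw [abs_mul, abs_mul, abs_of_pos hk0, abs_of_pos hc]
    calc k * |x| = c * (2 / Real.pi * |x|) := by rw [hk]; ring
      _ ≤ _ := mul_le_mul_of_nonneg_left hs hc.le
  have h4 : ∫ x in (-(Real.pi / 2))..(Real.pi / 2), (1 + (k * x) ^ 2)⁻¹ ≤ k⁻¹ * Real.pi := by
    rw [intervalIntegral.integral_comp_mul_left (fun x => (1 + x ^ 2)⁻¹) hk0.ne',
      integral_inv_one_add_sq, smul_eq_mul]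
    refine mul_le_mul_of_nonneg_left ?_ (by positivity)
    linarith [Real.arctan_lt_pi_div_two (k * (Real.pi / 2)),
      Real.neg_pi_div_two_lt_arctan (k * -(Real.pi / 2))]
  change ∫ θ in (0 : ℝ)..(2 * Real.pi), h (q * θ) ≤ _
  rw [h1, h2]
  calc (q : ℝ)⁻¹ * (2 * q * ∫ x in (-(Real.pi / 2))..(Real.pi / 2), h x)
      = 2 * ∫ x in (-(Real.pi / 2))..(Real.pi / 2), h x := by field_simp
    _ ≤ 2 * (k⁻¹ * Real.pi) := by linarith
    _ = Real.pi ^ 2 / c := by rw [hk]; field_simp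

end LorentzIntegral

/-! ### Dephasing of time averages in an eigenbasis -/

section Dephasing

open scoped InnerProductSpace

variable {E ι : Type*} [NormedAddCommGroup E] [InnerProductSpace ℂ E] [CompleteSpace E] [Fintype ι]

theorem norm_integral_exp_le {ω : ℝ} (hω : ω ≠ 0) (t : ℝ) :
    ‖∫ τ in (0 : ℝ)..t, Complex.exp (Complex.I * τ * ω)‖ ≤ 2 / |ω| := by
  have hc : Complex.I * (ω : ℂ) ≠ 0 := mul_ne_zero Complex.I_ne_zero (Complex.ofReal_ne_zero.2 hω)
  have e : ∀ τ : ℝ, Complex.exp (Complex.I * τ * ω) = Complex.exp (Complex.I * ω * τ) :=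
    fun τ => by ring_nf
  simp only [e]
  rw [integral_exp_mul_complex hc, norm_div, norm_mul, Complex.norm_I, one_mul, Complex.norm_real,
    Real.norm_eq_abs]
  refine div_le_div_of_nonneg_right ?_ (abs_nonneg _)
  refine (norm_sub_le _ _).trans ?_
  have h1 : ∀ τ : ℝ, ‖Complex.exp (Complex.I * ω * τ)‖ = 1 := fun τ => by
    rw [mul_assoc, mul_comm, ← Complex.ofReal_mul, Complex.norm_exp_ofReal_mul_I]
  rw [h1, h1]; norm_num

theorem inner_timeAverage_eigenvector {J P : E →L[ℂ] E} (hJ : IsSelfAdjoint J) {x y : E} {l m : ℝ}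
    (hx : J x = (l : ℂ) • x) (hy : J y = (m : ℂ) • y) (t : ℝ) :
    ⟪x, timeAverage J P t y⟫_ℂ
      = ((t⁻¹ : ℝ) : ℂ) * ((∫ τ in (0 : ℝ)..t, Complex.exp (Complex.I * τ * ((l - m : ℝ) : ℂ)))
        * ⟪x, P y⟫_ℂ) := by
  rw [inner_timeAverage, ← intervalIntegral.integral_mul_const]
  congr 2
  ext τ
  simp only [conjugated, mul_apply_eq_comp]
  have h1 := inner_propagator_left hJ (-τ) x (P (propagator J (-τ) y))
  rw [neg_neg] at h1
  rw [← h1, propagator_eigenvector hx, propagator_eigenvector hy, map_smul, inner_smul_left,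
    inner_smul_right, ← mul_assoc, ← Complex.exp_conj, ← Complex.exp_add]
  congr 2
  simp
  ring

/-- Quantitative dephasing: for a self-adjoint operator with eigenvalue gaps at least `g`, time
averages converge at rate `1 / (g t)`. -/
theorem norm_timeAverage_sub_le {J P : E →L[ℂ] E} (hJ : IsSelfAdjoint J)
    (v : OrthonormalBasis ι ℂ E) {ev : ι → ℝ} (hv : ∀ i, J (v i) = (ev i : ℂ) • v i) {g : ℝ}
    (hg : 0 < g) (hgap : ∀ i j, i ≠ j → g ≤ |ev i - ev j|) {s t : ℝ} (ht : 0 < t) (hst : t ≤ s)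
    (x : E) : ‖timeAverage J P s x - timeAverage J P t x‖
      ≤ Fintype.card ι ^ 2 * (4 * ‖P‖ / (t * g)) * ‖x‖ := by
  have hs : 0 < s := ht.trans_le hst
  set M := timeAverage J P s - timeAverage J P t with hM
  set β : ℝ := 4 * ‖P‖ / (t * g) with hβ
  have hβ0 : 0 ≤ β := by positivity
  have hoff : ∀ r, t ≤ r → ∀ i j, i ≠ j → ‖⟪v i, timeAverage J P r (v j)⟫_ℂ‖ ≤ 2 * ‖P‖ / (t * g) := by
    intro r hr i j hij
    have hω := hgap i j hij
    have hω0 : ev i - ev j ≠ 0 := fun h => by rw [h, abs_zero] at hω; linarith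
    rw [inner_timeAverage_eigenvector hJ (hv i) (hv j), norm_mul, norm_mul, Complex.norm_real,
      Real.norm_of_nonneg (inv_nonneg.2 (ht.le.trans hr))]
    have h1 : ‖⟪v i, P (v j)⟫_ℂ‖ ≤ ‖P‖ := by
      refine (norm_inner_le_norm _ _).trans ?_
      rw [v.orthonormal.1 i, one_mul]
      refine (P.le_opNorm _).trans_eq ?_
      rw [v.orthonormal.1 j, mul_one]
    have h2 := (norm_integral_exp_le hω0 r).trans (div_le_div_of_nonneg_left zero_le_two hg hω)
    calc _ ≤ t⁻¹ * (2 / g * ‖P‖) := mul_le_mul (inv_anti₀ ht hr)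
          (mul_le_mul h2 h1 (norm_nonneg _) (by positivity)) (by positivity) (by positivity)
      _ = _ := by field_simp
  have hent : ∀ i j, ‖⟪v i, M (v j)⟫_ℂ‖ ≤ β := by
    intro i j
    rw [hM, sub_apply, inner_sub_right]
    by_cases hij : i = j
    · subst hij
      rw [inner_timeAverage_eigenvector hJ (hv i) (hv i), inner_timeAverage_eigenvector hJ (hv i) (hv i)]
      -- On the diagonal the phases cancel, so the entry is the same for every averaging time and
      -- drops out of the difference.
      have : ∀ r : ℝ, 0 < r → ((r⁻¹ : ℝ) : ℂ) * ((∫ τ in (0 : ℝ)..r,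
          Complex.exp (Complex.I * τ * ((ev i - ev i : ℝ) : ℂ))) * ⟪v i, P (v i)⟫_ℂ)
          = ⟪v i, P (v i)⟫_ℂ := fun r hr => by
        have hr' : (r : ℂ) ≠ 0 := Complex.ofReal_ne_zero.2 hr.ne'
        simp [hr']
      rw [this s hs, this t ht, sub_self, norm_zero]
      exact hβ0
    · refine (norm_sub_le _ _).trans ((add_le_add (hoff s hst i j hij) (hoff t le_rfl i j hij)).trans_eq ?_)
      rw [hβ]; ring
  have hcol : ∀ j, ‖M (v j)‖ ≤ Fintype.card ι * β := by
    intro j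
    rw [← v.sum_repr' (M (v j))]
    refine (norm_sum_le _ _).trans ((Finset.sum_le_sum (g := fun _ => β) fun i _ => ?_).trans_eq ?_)
    · rw [norm_smul, v.orthonormal.1 i, mul_one]; exact hent i j
    · simp
  have hMx : M x = ∑ j, ⟪v j, x⟫_ℂ • M (v j) := by
    conv_lhs => rw [← v.sum_repr' x]
    simp
  rw [← sub_apply, ← hM, hMx]
  have : ∀ j ∈ Finset.univ, ‖⟪v j, x⟫_ℂ • M (v j)‖ ≤ ‖x‖ * (Fintype.card ι * β) := fun j _ => by
    rw [norm_smul]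
    refine mul_le_mul ?_ (hcol j) (norm_nonneg _) (norm_nonneg _)
    refine (norm_inner_le_norm _ _).trans_eq ?_
    rw [v.orthonormal.1 j, one_mul]
  refine (norm_sum_le _ _).trans ((Finset.sum_le_sum this).trans_eq ?_)
  rw [Finset.sum_const, Finset.card_univ, nsmul_eq_mul]; ring

end Dephasing

/-! ### Gap and dephasing estimates in a Bloch fibre -/

section FiberEstimate

open ComplexConjugate
open scoped InnerProductSpace

variable {q : ℕ} [NeZero q]

/-- The function on residues modulo `q` that represents a `q`-periodic sequence. -/
def residual (q : ℕ) (c : ℤ → ℝ) (m : ZMod q) : ℝ := c (m.val : ℤ)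

theorem residual_intCast {c : ℤ → ℝ} (hc : ∀ n, c (n + q) = c n) (n : ℤ) :
    residual q c (n : ZMod q) = c n := by
  have hp : Function.Periodic c (q : ℤ) := hc
  rw [residual, ZMod.val_intCast, Int.emod_def, mul_comm]
  exact hp.sub_int_mul_eq _

theorem sum_range_residues {M : Type*} [AddCommMonoid M] (f : ZMod q → M) :
    ∑ n ∈ Finset.range q, f ((n : ℤ) : ZMod q) = ∑ m, f m := by
  refine Finset.sum_nbij' (fun n => (n : ZMod q)) ZMod.val (fun _ _ => Finset.mem_univ _)
    (fun m _ => Finset.mem_range.2 (ZMod.val_lt m))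
    (fun n hn => ZMod.val_cast_of_lt (Finset.mem_range.1 hn))
    (fun m _ => ZMod.natCast_zmod_val m) (fun n _ => by simp)

/-- The Bloch wave on `ℤ` with profile `p` and quasi-momentum `θ`. -/
def blochWave (θ : ℝ) (p : Fiber q) (n : ℤ) : ℂ := phase (θ * n) * p (n : ZMod q)

omit [NeZero q] in
theorem norm_blochWave (θ : ℝ) (p : Fiber q) (n : ℤ) : ‖blochWave θ p n‖ = ‖p (n : ZMod q)‖ := by
  rw [blochWave, norm_mul, norm_phase, one_mul]

omit [NeZero q] in
theorem blochWave_add (θ : ℝ) (p : Fiber q) (n : ℤ) :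
    blochWave θ p (n + q) = phase (q * θ) * blochWave θ p n := by
  have : phase (θ * ((n + q : ℤ) : ℝ)) = phase (q * θ) * phase (θ * n) := by
    rw [← phase_add]; congr 1; push_cast; ring
  have h : ((n + q : ℤ) : ZMod q) = n := by simp
  rw [blochWave, blochWave, this, h, mul_assoc]

theorem isSolution_blochWave {a b : ℤ → ℝ} (haq : ∀ n, a (n + q) = a n)
    (hbq : ∀ n, b (n + q) = b n) {θ l : ℝ} {p : Fiber q}
    (hp : fiberJacobi (residual q a) (residual q b) θ p = (l : ℂ) • p) :
    IsSolution a b l (blochWave θ p) := by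
  intro n
  have h := congrArg (fun r : Fiber q => r (n : ZMod q)) hp
  have e1 : (n : ZMod q) + -1 = ((n - 1 : ℤ) : ZMod q) := by push_cast; ring
  have e2 : (n : ZMod q) + 1 = ((n + 1 : ℤ) : ZMod q) := by push_cast; ring
  simp only [fiberJacobi, add_apply, smul_apply, mul_apply_eq_comp, PiLp.add_apply,
    PiLp.smul_apply, fiberShift_apply, fiberDiag_apply, smul_eq_mul, e1, e2,
    residual_intCast haq, residual_intCast hbq] at h
  have p1 : phase (θ * ((n - 1 : ℤ) : ℝ)) = phase (θ * n) * phase (-θ) := by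
    rw [← phase_add]; congr 1; push_cast; ring
  have p2 : phase (θ * ((n + 1 : ℤ) : ℝ)) = phase (θ * n) * phase θ := by
    rw [← phase_add]; congr 1; push_cast; ring
  simp only [blochWave, p1, p2]
  linear_combination phase (θ * n) * h

/-- The exponentially large inverse of the spectral gaps. -/
def gapConstant (R : ℝ) (q : ℕ) : ℝ := 8 * R * q ^ 2 * (8 * R ^ 2) ^ (3 * q)

/-- Orthonormal fibre eigenvectors unfold to Bloch waves on ℤ with common multiplier ζ = e^{iqθ};
the phases cancel in sums over a period, and |ζ² - 1| = 2|sin(qθ)|. -/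
theorem fiber_gap {R : ℝ} (hR : 1 ≤ R) {a b : ℤ → ℝ} (ha : ∀ n, R⁻¹ ≤ a n ∧ a n ≤ R)
    (hb : ∀ n, |b n| ≤ R) (haq : ∀ n, a (n + q) = a n) (hbq : ∀ n, b (n + q) = b n)
    {θ l m : ℝ} {x y : Fiber q}
    (hx : fiberJacobi (residual q a) (residual q b) θ x = (l : ℂ) • x)
    (hy : fiberJacobi (residual q a) (residual q b) θ y = (m : ℂ) • y)
    (hx1 : ‖x‖ = 1) (hy1 : ‖y‖ = 1) (hxy : ⟪y, x⟫_ℂ = 0) :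
    2 * |Real.sin (q * θ)| ≤ gapConstant R q * |l - m| := by
  have hR0 : 0 ≤ R := by linarith
  have ha' : ∀ k : ZMod q, |residual q a k| ≤ R := fun k =>
    abs_le.2 ⟨by linarith [(ha k.val).1, inv_nonneg.2 hR0, show residual q a k = a k.val from rfl],
      (ha _).2⟩
  have hev : ∀ {l : ℝ} {x : Fiber q},
      fiberJacobi (residual q a) (residual q b) θ x = (l : ℂ) • x → ‖x‖ = 1 → |l| ≤ 3 * R := by
    intro l x hx hx1
    have := norm_fiberJacobi_le (b := residual q b) hR0 ha' (fun k => hb k.val) θ x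
    rwa [hx, norm_smul, Complex.norm_real, hx1, mul_one, mul_one] at this
  have hnorm : ∀ {x : Fiber q}, ‖x‖ = 1 → ∑ n ∈ Finset.range q, ‖blochWave θ x n‖ ^ 2 = 1 := by
    intro x hx1
    simp only [norm_blochWave]
    rw [sum_range_residues (fun k => ‖x k‖ ^ 2), ← EuclideanSpace.norm_sq_eq, hx1, one_pow]
  have horth : ∑ n ∈ Finset.range q, conj (blochWave θ y n) * blochWave θ x n = 0 := by
    have e : ∀ n : ℤ, conj (blochWave θ y n) * blochWave θ x n
        = conj (y (n : ZMod q)) * x (n : ZMod q) := fun n => by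
      have h1 : conj (phase (θ * n)) * phase (θ * n) = 1 := by
        rw [Complex.conj_mul', norm_phase]; simp
      simp only [blochWave, map_mul]
      linear_combination (conj (y (n : ZMod q)) * x (n : ZMod q)) * h1
    simp only [e]
    rw [sum_range_residues (fun k => conj (y k) * x k), ← hxy, PiLp.inner_apply]
    refine Finset.sum_congr rfl fun k _ => ?_
    simp [mul_comm]
  have h := gap_bound hR ha hb (NeZero.pos q) haq (norm_phase (q * θ)) (hev hx hx1) (hev hy hy1)
    (isSolution_blochWave haq hbq hx) (isSolution_blochWave haq hbq hy) (blochWave_add θ x)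
    (blochWave_add θ y) (hnorm hx1) (hnorm hy1) horth
  refine le_trans (le_of_eq ?_) h
  have e2 : phase (q * θ) ^ 2 = Complex.exp (Complex.I * ((2 * (q * θ) : ℝ) : ℂ)) := by
    rw [phase, ← Complex.exp_nat_mul]; congr 1; push_cast; ring
  rw [e2, Complex.norm_exp_I_mul_ofReal_sub_one, mul_div_cancel_left₀ _ two_ne_zero]
  simp

/-- Combines the trivial bound 4R, valid for all θ, with the dephasing bound 4Rκ/(t|sin(qθ)|), which
degenerates at band edges; adding their squares gives the Lorentzian profile and the constant 32R².
-/
theorem fiber_dephasing {R : ℝ} (hR : 1 ≤ R) {a b : ℤ → ℝ} (ha : ∀ n, R⁻¹ ≤ a n ∧ a n ≤ R)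
    (hb : ∀ n, |b n| ≤ R) (haq : ∀ n, a (n + q) = a n) (hbq : ∀ n, b (n + q) = b n)
    (θ : ℝ) {s t : ℝ} (ht : 0 < t) (hst : t ≤ s) (x : Fiber q) (hx : ‖x‖ = 1) :
    ‖timeAverage (fiberJacobi (residual q a) (residual q b) θ) (fiberVelocity (residual q a) θ) s x
      - timeAverage (fiberJacobi (residual q a) (residual q b) θ)
        (fiberVelocity (residual q a) θ) t x‖ ^ 2
      ≤ 32 * R ^ 2 * (1 + (t / (q ^ 2 * gapConstant R q) * Real.sin (q * θ)) ^ 2)⁻¹ := by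
  set J := fiberJacobi (residual q a) (residual q b) θ with hJdef
  set P := fiberVelocity (residual q a) θ with hPdef
  have hR0 : 0 < R := by linarith
  have hq0 : (0 : ℝ) < q := Nat.cast_pos.2 (NeZero.pos q)
  have hG : 0 < gapConstant R q := by unfold gapConstant; positivity
  set κ : ℝ := q ^ 2 * gapConstant R q with hκ
  have hκ0 : 0 < κ := by positivity
  have hJ : IsSelfAdjoint J := isSelfAdjoint_fiberJacobi _ _ _
  have hP : ‖P‖ ≤ 2 * R := norm_fiberVelocity_le hR0.le (fun k =>
    abs_le.2 ⟨by linarith [(ha k.val).1, inv_nonneg.2 hR0.le, show residual q a k = a k.val from rfl],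
      (ha _).2⟩) θ
  set Y := ‖timeAverage J P s x - timeAverage J P t x‖ with hY
  have hY0 : 0 ≤ Y := norm_nonneg _
  have h1 : Y ≤ 4 * R := by
    have e1 := norm_timeAverage_apply_le hJ P (ht.trans_le hst) x
    have e2 := norm_timeAverage_apply_le hJ P ht x
    rw [hx, mul_one] at e1 e2
    refine (norm_sub_le _ _).trans ?_
    linarith
  have h2 : Y * (t * |Real.sin (q * θ)|) ≤ 4 * R * κ := by
    -- At a band edge the gap bound is void, but the multiplied inequality is then trivial.
    by_cases hsin : Real.sin (q * θ) = 0
    · rw [hsin, abs_zero, mul_zero, mul_zero]; positivity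
    have hsin' : 0 < |Real.sin (q * θ)| := abs_pos.2 hsin
    have hsym : (J : Fiber q →ₗ[ℂ] Fiber q).IsSymmetric := hJ.isSymmetric
    have hfr : Module.finrank ℂ (Fiber q) = q := by simp
    have hgap : ∀ i j, i ≠ j →
        2 * |Real.sin (q * θ)| / gapConstant R q ≤ |hsym.eigenvalues hfr i - hsym.eigenvalues hfr j| := by
      intro i j hij
      rw [div_le_iff₀' hG]
      exact fiber_gap hR ha hb haq hbq (hsym.apply_eigenvectorBasis hfr i)
        (hsym.apply_eigenvectorBasis hfr j) ((hsym.eigenvectorBasis hfr).orthonormal.1 i)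
        ((hsym.eigenvectorBasis hfr).orthonormal.1 j)
        ((hsym.eigenvectorBasis hfr).orthonormal.2 hij.symm)
    have h3 := norm_timeAverage_sub_le (P := P) hJ (hsym.eigenvectorBasis hfr)
      (fun i => hsym.apply_eigenvectorBasis hfr i) (by positivity) hgap ht hst x
    rw [hx, mul_one, Fintype.card_fin] at h3
    calc Y * (t * |Real.sin (q * θ)|)
        ≤ ((q : ℝ) ^ 2 * (4 * ‖P‖ / (t * (2 * |Real.sin (q * θ)| / gapConstant R q))))
          * (t * |Real.sin (q * θ)|) := mul_le_mul_of_nonneg_right h3 (by positivity)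
      _ = 2 * ‖P‖ * κ := by rw [hκ]; field_simp; ring
      _ ≤ 2 * (2 * R) * κ := by gcongr
      _ = 4 * R * κ := by ring
  rw [← div_eq_mul_inv, le_div_iff₀ (by positivity)]
  have h3 : Y * (t / κ * |Real.sin (q * θ)|) ≤ 4 * R := by
    rw [show Y * (t / κ * |Real.sin (q * θ)|) = Y * (t * |Real.sin (q * θ)|) / κ by ring,
      div_le_iff₀ hκ0]
    exact h2
  have h4 := pow_le_pow_left₀ hY0 h1 2
  have h5 := pow_le_pow_left₀ (by positivity) h3 2
  rw [mul_pow, mul_pow, sq_abs, ← mul_pow] at h5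
  nlinarith

end FiberEstimate

/-! ### Convergence rate on unit vectors of ℓ²(ℤ) -/

section LatticeEstimate

theorem inclusion_single (n : ℤ) : inclusion (lp.single 1 n 1) = lp.single 2 n 1 := by
  ext k
  rw [inclusion_apply]; rfl

theorem timeAverage_single_sub_sq_le {R : ℝ} (hR : 1 ≤ R) {q : ℕ} (hq : 0 < q) {a b : ℓ^∞(ℤ, ℝ)}
    (ha : ∀ n, R⁻¹ ≤ a n ∧ a n ≤ R) (hb : ∀ n, |b n| ≤ R) (haq : ∀ n, a (n + q) = a n)
    (hbq : ∀ n, b (n + q) = b n) {s t : ℝ} (ht : 0 < t) (hst : t ≤ s) (n : ℤ) :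
    2 * Real.pi * ‖timeAverage (jacobi a b) (velocity a) s (lp.single 2 n 1)
      - timeAverage (jacobi a b) (velocity a) t (lp.single 2 n 1)‖ ^ 2
      ≤ 32 * R ^ 2 * ∫ θ in (0 : ℝ)..(2 * Real.pi),
        (1 + (t / (q ^ 2 * gapConstant R q) * Real.sin (q * θ)) ^ 2)⁻¹ := by
  have : NeZero q := ⟨hq.ne'⟩
  set δ : L1 := lp.single 1 n 1 with hδ
  -- The difference of averages is formed in ℓ¹, so its Bloch transform makes sense at every θ, not
  -- just almost everywhere.
  set ψ : L1 := timeAverage (jacobiL1 a b) (velocityL1 a) s δ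
    - timeAverage (jacobiL1 a b) (velocityL1 a) t δ with hψ
  have e : timeAverage (jacobi a b) (velocity a) s (lp.single 2 n 1)
      - timeAverage (jacobi a b) (velocity a) t (lp.single 2 n 1) = inclusion ψ := by
    rw [hψ, map_sub, timeAverage_intertwine (inclusion_jacobi a b) (inclusion_velocity a),
      timeAverage_intertwine (inclusion_jacobi a b) (inclusion_velocity a), hδ, inclusion_single]
  rw [e, ← integral_norm_bloch_sq (q := q), ← intervalIntegral.integral_const_mul]
  refine intervalIntegral.integral_mono_on (by positivity) ?_ ?_ (fun θ _ => ?_)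
  · refine Continuous.intervalIntegrable ?_ _ _
    simp only [EuclideanSpace.norm_sq_eq]
    exact continuous_finsetSum _ fun m _ => (continuous_bloch ψ m).norm.pow 2
  · refine Continuous.intervalIntegrable (continuous_const.mul ?_) _ _
    exact Continuous.inv₀ (by fun_prop) (fun x => by positivity)
  · have hJ := bloch_jacobi (q := q) θ (a := a) (b := b) (residual_intCast haq)
      (residual_intCast hbq)
    have hV := bloch_velocity (q := q) θ (a := a) (residual_intCast haq)
    rw [hψ, map_sub, timeAverage_intertwine hJ hV, timeAverage_intertwine hJ hV]
    exact fiber_dephasing hR ha hb haq hbq θ ht hst _ (norm_bloch_single θ n)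

/-- The constant in the rate of convergence of the time averages. -/
def rateConstant (R : ℝ) (q : ℕ) : ℝ := 8 * R * (q ^ 2 * gapConstant R q)

theorem timeAverage_single_sub_le {R : ℝ} (hR : 1 ≤ R) {q : ℕ} (hq : 0 < q) {a b : ℓ^∞(ℤ, ℝ)}
    (ha : ∀ n, R⁻¹ ≤ a n ∧ a n ≤ R) (hb : ∀ n, |b n| ≤ R) (haq : ∀ n, a (n + q) = a n)
    (hbq : ∀ n, b (n + q) = b n) {s t : ℝ} (ht : 0 < t) (hst : t ≤ s) (n : ℤ) :
    ‖timeAverage (jacobi a b) (velocity a) s (lp.single 2 n 1)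
      - timeAverage (jacobi a b) (velocity a) t (lp.single 2 n 1)‖
      ≤ rateConstant R q * t ^ (-(1 / 5) : ℝ) := by
  have h := timeAverage_single_sub_sq_le hR hq ha hb haq hbq ht hst n
  set Y := ‖timeAverage (jacobi a b) (velocity a) s (lp.single 2 n 1)
      - timeAverage (jacobi a b) (velocity a) t (lp.single 2 n 1)‖ with hY
  have hq1 : (1 : ℝ) ≤ q := by exact_mod_cast hq
  have hR2 : 1 ≤ R ^ 2 := one_le_pow₀ hR
  set κ : ℝ := q ^ 2 * gapConstant R q with hκ
  have hκ1 : 1 ≤ κ := by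
    have e1 : (1 : ℝ) ≤ q ^ 2 := one_le_pow₀ hq1
    have e2 : 1 ≤ (8 * R ^ 2) ^ (3 * q) := one_le_pow₀ (by linarith)
    have e3 : 1 ≤ 8 * R * q ^ 2 := one_le_mul_of_one_le_of_one_le (by linarith) e1
    exact one_le_mul_of_one_le_of_one_le e1 (one_le_mul_of_one_le_of_one_le e3 e2)
  have hκ0 : 0 < κ := by linarith
  have hπ := Real.pi_pos
  set T := t ^ (-(1 / 5) : ℝ) with hT
  have hT0 : 0 < T := Real.rpow_pos_of_pos ht _
  have hsq : Y ^ 2 ≤ (8 * R * κ * T) ^ 2 := by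
    have hRκ : R ^ 2 * κ ≤ R ^ 2 * κ ^ 2 :=
      mul_le_mul_of_nonneg_left (by nlinarith) (by positivity)
    -- For t ≥ 1 the Lorentzian gives Y² = O(1/t), and 1/t ≤ t^{-2/5}. For t ≤ 1 the integrand is
    -- bounded by 1 and t^{-1/5} ≥ 1.
    rcases le_total 1 t with h1 | h1
    · have h2 := integral_lorentz_le (c := t / κ) (by positivity) hq
      have h3 : 2 * Real.pi * Y ^ 2 ≤ 2 * Real.pi * (16 * Real.pi * (R ^ 2 * κ) * t⁻¹) := by
        refine h.trans ((mul_le_mul_of_nonneg_left h2 (by positivity)).trans_eq ?_)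
        field_simp
        ring
      have h4 := le_of_mul_le_mul_left h3 (by positivity)
      have h5 : t⁻¹ ≤ T ^ 2 := by
        rw [hT, ← Real.rpow_natCast, ← Real.rpow_mul ht.le, ← Real.rpow_neg_one]
        exact Real.rpow_le_rpow_of_exponent_le h1 (by norm_num)
      calc Y ^ 2 ≤ 16 * Real.pi * (R ^ 2 * κ) * t⁻¹ := h4
        _ ≤ 16 * 4 * (R ^ 2 * κ ^ 2) * T ^ 2 := by
          have := Real.pi_le_four
          gcongr
        _ = _ := by ring
    · have h2 : ∫ θ in (0 : ℝ)..(2 * Real.pi), (1 + (t / κ * Real.sin (q * θ)) ^ 2)⁻¹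
          ≤ ∫ θ in (0 : ℝ)..(2 * Real.pi), (1 : ℝ) := by
        refine intervalIntegral.integral_mono_on (by positivity) ?_
          (continuous_const.intervalIntegrable _ _)
          (fun θ _ => inv_le_one_of_one_le₀ (by linarith [sq_nonneg (t / κ * Real.sin (q * θ))]))
        refine Continuous.intervalIntegrable ?_ _ _
        exact Continuous.inv₀ (by fun_prop) (fun x => by positivity)
      rw [intervalIntegral.integral_const, sub_zero, smul_eq_mul, mul_one] at h2
      have h3 : 2 * Real.pi * Y ^ 2 ≤ 2 * Real.pi * (32 * R ^ 2) := by
        refine h.trans ((mul_le_mul_of_nonneg_left h2 (by positivity)).trans_eq ?_)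
        ring
      have h4 := le_of_mul_le_mul_left h3 (by positivity)
      have h5 : 1 ≤ T := Real.one_le_rpow_of_pos_of_le_one_of_nonpos ht h1 (by norm_num)
      calc Y ^ 2 ≤ 32 * R ^ 2 := h4
        _ ≤ 64 * R ^ 2 * 1 * 1 := by nlinarith
        _ ≤ 64 * R ^ 2 * κ ^ 2 * T ^ 2 := by
          gcongr
          · exact one_le_pow₀ hκ1
          · exact one_le_pow₀ h5
        _ = _ := by ring
  have hR0 : 0 < R := by linarith
  change Y ≤ 8 * R * κ * T
  exact (sq_le_sq₀ (norm_nonneg _) (by positivity)).1 hsq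

/-- Polynomial factors are absorbed using q ≤ 2^q, and 524288 = 64 · 2⁴ · 8³. The added 1 makes the
base exceed 1 for every R > 0. -/
theorem rateConstant_le {R : ℝ} (hR : 1 ≤ R) {q : ℕ} (hq : 0 < q) :
    rateConstant R q ≤ (524288 * R ^ 8 + 1) ^ q := by
  have hR0 : 0 < R := by linarith
  have h2 : (q : ℝ) ≤ 2 ^ q := by exact_mod_cast q.lt_two_pow_self.le
  have h64 : 64 * R ^ 2 ≤ (64 * R ^ 2) ^ q :=
    le_self_pow₀ (by nlinarith [one_le_pow₀ hR (n := 2)]) hq.ne'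
  calc rateConstant R q = 64 * R ^ 2 * (q : ℝ) ^ 4 * (8 * R ^ 2) ^ (3 * q) := by
        unfold rateConstant gapConstant; ring
    _ ≤ (64 * R ^ 2) ^ q * (2 ^ q) ^ 4 * (8 * R ^ 2) ^ (3 * q) := by gcongr
    _ = (524288 * R ^ 8) ^ q := by
        rw [pow_mul, ← pow_mul, mul_comm q 4, pow_mul, ← mul_pow, ← mul_pow]; congr 1; ring
    _ ≤ _ := by gcongr; linarith

end LatticeEstimate

/-! ### Coefficient bounds and summability on D(X) -/

section Coefficients

theorem norm_single_two (n : ℤ) : ‖(lp.single 2 n 1 : H)‖ = 1 := by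
  rw [lp.norm_single (by norm_num)]; simp

/-- The coefficient is the matrix element of J between neighbouring unit vectors. -/
theorem coeff_le_norm_jacobi (a b : ℓ^∞(ℤ, ℝ)) (n : ℤ) : |a n| ≤ ‖jacobi a b‖ := by
  have h1 := lp.norm_apply_le_norm (by norm_num) (jacobi a b (lp.single 2 (n + 1) 1)) n
  have h2 := (jacobi a b).le_opNorm (lp.single 2 (n + 1) 1)
  rw [norm_single_two, mul_one] at h2
  refine le_trans (le_of_eq ?_) (h1.trans h2)
  rw [jacobi_apply]
  have e1 : (lp.single 2 (n + 1) 1 : H) (n - 1) = 0 := lp.single_apply_ne _ _ _ (by omega)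
  have e2 : (lp.single 2 (n + 1) 1 : H) n = 0 := lp.single_apply_ne _ _ _ (by omega)
  have e3 : (lp.single 2 (n + 1) 1 : H) (n + 1) = 1 := lp.single_apply_self _ _ _
  rw [e1, e2, e3]
  simp

theorem potential_le_norm_jacobi (a b : ℓ^∞(ℤ, ℝ)) (n : ℤ) : |b n| ≤ ‖jacobi a b‖ := by
  have h1 := lp.norm_apply_le_norm (by norm_num) (jacobi a b (lp.single 2 n 1)) n
  have h2 := (jacobi a b).le_opNorm (lp.single 2 n 1)
  rw [norm_single_two, mul_one] at h2
  refine le_trans (le_of_eq ?_) (h1.trans h2)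
  rw [jacobi_apply]
  have e1 : (lp.single 2 n 1 : H) (n - 1) = 0 := lp.single_apply_ne _ _ _ (by omega)
  have e2 : (lp.single 2 n 1 : H) (n + 1) = 0 := lp.single_apply_ne _ _ _ (by omega)
  have e3 : (lp.single 2 n 1 : H) n = 1 := lp.single_apply_self _ _ _
  rw [e1, e2, e3]
  simp

theorem InClass.coeff_bounds {R : ℝ} {a b : ℓ^∞(ℤ, ℝ)} (h : InClass R a b) (n : ℤ) :
    R⁻¹ ≤ a n ∧ a n ≤ R := by
  refine ⟨h.inv_le_iInf.trans (ciInf_le ⟨-‖a‖, ?_⟩ n),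
    (le_abs_self _).trans ((coeff_le_norm_jacobi a b n).trans h.norm_le)⟩
  rintro _ ⟨k, rfl⟩
  exact (abs_le.1 (lp.norm_apply_le_norm (by simp) a k)).1

theorem InClass.one_le {R : ℝ} (hR : 0 < R) {a b : ℓ^∞(ℤ, ℝ)} (h : InClass R a b) : 1 ≤ R := by
  have h1 := (h.coeff_bounds 0).1.trans (h.coeff_bounds 0).2
  rw [inv_le_iff_one_le_mul₀ hR] at h1
  nlinarith

/-- Vectors in the domain of the position operator are summable. -/
theorem summable_of_mem_domain {φ : H} (hφ : φ ∈ position.domain) :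
    Summable fun n : ℤ => ‖φ n‖ := by
  have h1 : Summable fun n : ℤ => ‖(n : ℂ) * φ n‖ ^ 2 := by
    have := (memℓp_gen_iff (p := 2) (by norm_num)).1 hφ
    simpa using this
  have h2 : Summable fun n : ℤ => 1 / (n : ℝ) ^ 2 :=
    Real.summable_one_div_int_pow.2 (by norm_num)
  -- Membership in D(X) says nothing about the entry at 0, which is discarded. Elsewhere |φ_n| is
  -- the product of 1/|n| and |nφ_n|, hence at most the sum of their squares.
  refine (summable_congr_cofinite ?_).1 (Summable.of_nonneg_of_le
    (f := fun n : ℤ => 1 / (n : ℝ) ^ 2 + ‖(n : ℂ) * φ n‖ ^ 2)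
    (g := fun n : ℤ => if n = 0 then 0 else ‖φ n‖) (fun n => by split_ifs <;> positivity)
    (fun n => ?_) (h2.add h1))
  · filter_upwards [(Set.finite_singleton (0 : ℤ)).compl_mem_cofinite] with n hn
    exact if_neg hn
  · split_ifs with hn
    · positivity
    · have hn' : (0 : ℝ) < |(n : ℝ)| := abs_pos.2 (Int.cast_ne_zero.2 hn)
      rw [norm_mul, Complex.norm_intCast, ← sq_abs (n : ℝ)]
      have e : ‖φ n‖ = (1 / |(n : ℝ)|) * (|(n : ℝ)| * ‖φ n‖) := by field_simp
      have e2 : 1 / |(n : ℝ)| ^ 2 = (1 / |(n : ℝ)|) ^ 2 := by rw [div_pow, one_pow]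
      rw [e2]
      nlinarith [sq_nonneg (1 / |(n : ℝ)| - |(n : ℝ)| * ‖φ n‖),
        sq_nonneg (1 / |(n : ℝ)|), sq_nonneg (|(n : ℝ)| * ‖φ n‖)]

end Coefficients

/-! ### Strong limits from convergence on unit vectors -/

section StrongLimit

open scoped InnerProductSpace

/-- A bounded family of operators on `ℓ²(ℤ)` that converges on the unit vectors converges
strongly. -/
theorem exists_strong_limit {A : ℝ → H →L[ℂ] H} {B : ℝ} (hB : 0 ≤ B)
    (hA : ∀ t, 0 < t → ∀ φ, ‖A t φ‖ ≤ B * ‖φ‖)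
    (hc : ∀ n : ℤ, ∃ y, Tendsto (fun t => A t (lp.single 2 n 1)) atTop (𝓝 y)) :
    ∃ Q : H →L[ℂ] H, ∀ φ, Tendsto (fun t => A t φ) atTop (𝓝 (Q φ)) := by
  have hfin : ∀ (F : Finset ℤ) (c : ℤ → ℂ),
      ∃ y, Tendsto (fun t => A t (∑ n ∈ F, c n • lp.single 2 n 1)) atTop (𝓝 y) := by
    intro F c
    choose y hy using hc
    refine ⟨∑ n ∈ F, c n • y n, ?_⟩
    simp only [map_sum, map_smul]
    exact tendsto_finsetSum _ fun n _ => (hy n).const_smul (c n)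
  have hlim : ∀ φ : H, ∃ y, Tendsto (fun t => A t φ) atTop (𝓝 y) := by
    intro φ
    refine cauchySeq_tendsto_of_complete (Metric.cauchySeq_iff'.2 fun ε hε => ?_)
    have h1 := lp.hasSum_single (p := 2) (by norm_num) φ
    have h2 : ∀ n, lp.single 2 n (φ n) = (φ n) • (lp.single 2 n 1 : H) := fun n => by
      rw [← lp.single_smul, smul_eq_mul, mul_one]
    simp only [h2] at h1
    obtain ⟨F, hF⟩ := ((Metric.tendsto_nhds.1 h1) (ε / (4 * (B + 1))) (by positivity)).exists
    obtain ⟨y, hy⟩ := hfin F (fun n => φ n)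
    set ψ : H := ∑ n ∈ F, φ n • lp.single 2 n 1 with hψ
    obtain ⟨N, hN⟩ := Metric.cauchySeq_iff'.1 hy.cauchySeq (ε / 4) (by positivity)
    have hd : ∀ t, 0 < t → dist (A t φ) (A t ψ) ≤ ε / 4 := fun t ht => by
      rw [dist_eq_norm, ← map_sub]
      refine (hA t ht _).trans ?_
      rw [← dist_eq_norm, dist_comm]
      calc B * dist ψ φ ≤ (B + 1) * (ε / (4 * (B + 1))) :=
            mul_le_mul (by linarith) hF.le dist_nonneg (by linarith)
        _ = ε / 4 := by field_simp
    refine ⟨max N 1, fun t ht => ?_⟩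
    have ht0 : 0 < t := lt_of_lt_of_le one_pos ((le_max_right _ _).trans ht)
    have d1 := hd t ht0
    have d2 := hd (max N 1) (lt_of_lt_of_le one_pos (le_max_right _ _))
    have d3 := hN t ((le_max_left _ _).trans ht)
    have d4 := hN (max N 1) (le_max_left _ _)
    have d5 := dist_triangle4 (A t φ) (A t ψ) (A (max N 1) ψ) (A (max N 1) φ)
    have d6 := dist_triangle_right (A t ψ) (A (max N 1) ψ) (A N ψ)
    rw [dist_comm (A (max N 1) ψ) (A (max N 1) φ)] at d5
    linarith
  choose Q hQ using hlim
  -- Boundedness of the pointwise limit is Banach–Steinhaus.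
  exact ⟨continuousLinearMapOfTendsto A (tendsto_pi_nhds.2 hQ), hQ⟩

theorem isSelfAdjoint_of_tendsto {A : ℝ → H →L[ℂ] H} {Q : H →L[ℂ] H}
    (hA : ∀ t x y, ⟪A t x, y⟫_ℂ = ⟪x, A t y⟫_ℂ)
    (hQ : ∀ φ, Tendsto (fun t => A t φ) atTop (𝓝 (Q φ))) : IsSelfAdjoint Q := by
  rw [ContinuousLinearMap.isSelfAdjoint_iff_isSymmetric]
  intro x y
  have h1 : Tendsto (fun t => ⟪A t x, y⟫_ℂ) atTop (𝓝 ⟪Q x, y⟫_ℂ) := (hQ x).inner tendsto_const_nhds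
  have h2 : Tendsto (fun t => ⟪x, A t y⟫_ℂ) atTop (𝓝 ⟪x, Q y⟫_ℂ) := tendsto_const_nhds.inner (hQ y)
  simp only [hA] at h1
  exact tendsto_nhds_unique h1 h2

theorem norm_apply_le_of_single {T : H →L[ℂ] H} {D : ℝ} (hT : ∀ n : ℤ, ‖T (lp.single 2 n 1)‖ ≤ D)
    {φ : H} (hφ : Summable fun n : ℤ => ‖φ n‖) : ‖T φ‖ ≤ D * ∑' n : ℤ, ‖φ n‖ := by
  have h1 := T.hasSum (lp.hasSum_single (p := 2) (by norm_num) φ)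
  rw [← h1.tsum_eq]
  refine tsum_of_norm_bounded (hφ.hasSum.mul_left D) fun n => ?_
  rw [show lp.single 2 n (φ n) = (φ n) • (lp.single 2 n 1 : H) by
    rw [← lp.single_smul, smul_eq_mul, mul_one], map_smul, norm_smul, mul_comm]
  exact mul_le_mul_of_nonneg_right (hT n) (norm_nonneg _)

end StrongLimit

/-- The strong limit of the time averages of the velocity, with its rate of convergence. -/
theorem exists_asymptotic_velocity {R : ℝ} (hR : 1 ≤ R) {q : ℕ} {a b : ℓ^∞(ℤ, ℝ)}
    (h : InClass R a b) (hper : IsPeriodic q a b) :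
    ∃ Q : H →L[ℂ] H, IsSelfAdjoint Q ∧
      (∀ φ, Tendsto (fun t => timeAverage (jacobi a b) (velocity a) t φ) atTop (𝓝 (Q φ))) ∧
      ∀ φ : H, Summable (fun n : ℤ => ‖φ n‖) → ∀ t : ℝ, 0 < t →
        ‖Q φ - timeAverage (jacobi a b) (velocity a) t φ‖
          ≤ rateConstant R q * t ^ (-(1 / 5) : ℝ) * ∑' n : ℤ, ‖φ n‖ := by
  have hrate : ∀ {s t : ℝ}, 0 < t → t ≤ s → ∀ n : ℤ, _ := fun ht hst n =>
    timeAverage_single_sub_le hR hper.1 h.coeff_bounds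
      (fun n => (potential_le_norm_jacobi a b n).trans h.norm_le) (fun n => (hper.2 n).1)
      (fun n => (hper.2 n).2) ht hst n
  have hJ := isSelfAdjoint_jacobi a b
  have hzero : Tendsto (fun t : ℝ => rateConstant R q * t ^ (-(1 / 5) : ℝ)) atTop (𝓝 0) := by
    have := (tendsto_rpow_neg_atTop (y := 1 / 5) (by norm_num)).const_mul (rateConstant R q)
    rwa [mul_zero] at this
  obtain ⟨Q, hQ⟩ := exists_strong_limit (norm_nonneg (velocity a))
    (fun t ht φ => norm_timeAverage_apply_le hJ (velocity a) ht φ) (fun n => by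
      refine cauchySeq_tendsto_of_complete (Metric.cauchySeq_iff'.2 fun ε hε => ?_)
      obtain ⟨N, hN, hN0⟩ := ((hzero.eventually_lt_const hε).and (eventually_gt_atTop 0)).exists
      exact ⟨N, fun t ht => by rw [dist_eq_norm]; exact (hrate hN0 ht n).trans_lt hN⟩)
  refine ⟨Q, isSelfAdjoint_of_tendsto
    (fun t x y => inner_timeAverage_left hJ (isSelfAdjoint_velocity a) t x y) hQ, hQ,
    fun φ hφ t ht => ?_⟩
  refine norm_apply_le_of_single (T := Q - timeAverage (jacobi a b) (velocity a) t)
    (fun n => ?_) hφ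
  -- The rate to the limit follows from the Cauchy estimate between times t ≤ s by sending s to
  -- infinity.
  refine le_of_tendsto ((hQ (lp.single 2 n 1)).sub_const _).norm ?_
  filter_upwards [eventually_ge_atTop t] with s hs
  exact hrate ht hs n

end JacobiTransport
end

/-! ### Assembly of the main theorem -/

open JacobiTransport
theorem mainTheorem5 (R : ℝ) (hR : 0 < R) :
    ∃ C₁ : ℝ, 1 < C₁ ∧
      ∀ (q : ℕ) (a b : ℓ^∞(ℤ, ℝ)), InClass R a b → IsPeriodic q a b →
        IsAsymptoticVelocity (jacobi a b) (asymptoticVelocity (jacobi a b)) ∧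
        ∀ (φ : H) (hφ : φ ∈ position.domain),
          Summable (fun n : ℤ => ‖φ n‖) ∧
          ∀ t : ℝ, 0 < t →
            ∃ ht : φ ∈ (heisenberg (jacobi a b) t).domain,
              ‖asymptoticVelocity (jacobi a b) φ
                  - ((t⁻¹ : ℝ) : ℂ) • heisenberg (jacobi a b) t ⟨φ, ht⟩‖
                ≤ t⁻¹ * ‖position ⟨φ, hφ⟩‖
                  + C₁ ^ q * (∑' n : ℤ, ‖φ n‖) * t ^ (-(1 / 5) : ℝ) := by
  refine ⟨524288 * R ^ 8 + 1, by linarith [pow_pos hR 8], fun q a b h hper => ?_⟩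
  have hR1 := h.one_le hR
  obtain ⟨Q, hQsa, hQ, hrate⟩ := exists_asymptotic_velocity hR1 h hper
  have hlim : ∀ φ (hφ : φ ∈ position.domain) (ht : ∀ t, φ ∈ (heisenberg (jacobi a b) t).domain),
      Tendsto (fun t : ℝ => ((t⁻¹ : ℝ) : ℂ) • heisenberg (jacobi a b) t ⟨φ, ht t⟩) atTop
        (𝓝 (Q φ)) := by
    intro φ hφ ht
    have e : ∀ t, ((t⁻¹ : ℝ) : ℂ) • heisenberg (jacobi a b) t ⟨φ, ht t⟩
        = ((t⁻¹ : ℝ) : ℂ) • position ⟨φ, hφ⟩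
          + timeAverage (jacobi a b) (velocity a) t φ := fun t =>
      (heisenberg_div_eq ⟨φ, hφ⟩ t).2
    simp only [e]
    have h0 : Tendsto (fun t : ℝ => ((t⁻¹ : ℝ) : ℂ)) atTop (𝓝 ((0 : ℝ) : ℂ)) :=
      (Complex.continuous_ofReal.tendsto 0).comp tendsto_inv_atTop_zero
    have h1 := (h0.smul_const (position ⟨φ, hφ⟩)).add (hQ φ)
    rwa [Complex.ofReal_zero, zero_smul, zero_add] at h1
  have hdom : ∀ φ ∈ position.domain, ∀ t, φ ∈ (heisenberg (jacobi a b) t).domain :=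
    fun φ hφ t => (heisenberg_div_eq ⟨φ, hφ⟩ t).1
  have hex : ∃ Q : H →L[ℂ] H, IsAsymptoticVelocity (jacobi a b) Q :=
    ⟨Q, hQsa, fun φ hφ => ⟨hdom φ hφ, hlim φ hφ (hdom φ hφ)⟩⟩
  have hspec : IsAsymptoticVelocity (jacobi a b) (asymptoticVelocity (jacobi a b)) := by
    rw [asymptoticVelocity, dif_pos hex]
    exact hex.choose_spec
  refine ⟨hspec, fun φ hφ => ⟨summable_of_mem_domain hφ, fun t ht => ⟨hdom φ hφ t, ?_⟩⟩⟩
  -- The chosen operator need not be syntactically Q; uniqueness of limits identifies the two on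
  -- D(X), which is all that is needed.
  have hφQ : asymptoticVelocity (jacobi a b) φ = Q φ := by
    obtain ⟨hd, hl⟩ := hspec.2 φ hφ
    exact tendsto_nhds_unique hl (hlim φ hφ hd)
  have he : ((t⁻¹ : ℝ) : ℂ) • heisenberg (jacobi a b) t ⟨φ, hdom φ hφ t⟩
      = ((t⁻¹ : ℝ) : ℂ) • position ⟨φ, hφ⟩ + timeAverage (jacobi a b) (velocity a) t φ :=
    (heisenberg_div_eq ⟨φ, hφ⟩ t).2
  have h1 := hrate φ (summable_of_mem_domain hφ) t ht
  have h2 : rateConstant R q * t ^ (-(1 / 5) : ℝ) * ∑' n : ℤ, ‖φ n‖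
      ≤ (524288 * R ^ 8 + 1) ^ q * (∑' n : ℤ, ‖φ n‖) * t ^ (-(1 / 5) : ℝ) := by
    rw [mul_right_comm]
    have h3 : 0 ≤ ∑' n : ℤ, ‖φ n‖ := tsum_nonneg fun _ => norm_nonneg _
    have h4 := Real.rpow_nonneg ht.le (-(1 / 5) : ℝ)
    exact mul_le_mul_of_nonneg_right (mul_le_mul_of_nonneg_right (rateConstant_le hR1 hper.1) h3) h4
  rw [hφQ, he, ← sub_sub, sub_right_comm]
  refine (norm_sub_le _ _).trans ?_
  rw [norm_smul, Complex.norm_real, Real.norm_of_nonneg (inv_nonneg.2 ht.le), add_comm]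
  exact add_le_add le_rfl (h1.trans h2)
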